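/- Let $T$ be an arbitrary complete first-order theory and let $\mathbb{M}\models T$ be a monster model: for some cardinal $\kappa>|T|$ with $\kappa=\beth_\kappa$, the model $\mathbb{M}$ is $\kappa$-saturated and strongly $\kappa$-homogeneous. "Small" and "bounded" mean "of cardinality less than $\kappa$". Let $A\subseteq\mathbb{M}$ be a small set and let $p(x)\in S(A)$ be a complete type in a small (possibly infinite) tuple $x$ of variables. A formula $\varphi(x,b)$ *divides* over $A$ if there are $k<\omega$ and a sequence $(b_i)_{i<\omega}$ of realizations of $\operatorname{tp}(b/A)$ such that $\{\varphi(x,b_i):i<\omega\}$ is $k$-inconsistent; it *forks* over $A$ if it implies a finite disjunction of formulas, with parameters in $\mathbb{M}$, each of which divides over $A$; a complete type forks over $A$ if it contains a formula that forks over $A$. The type $p$ is *extensible* if it has a global extension (a complete type over $\mathbb{M}$ containing $p$) that does not fork over $A$. A *Morley sequence* over $A$ is an $A$-indiscernible sequence $(a_i)_{i<\omega}$ such that $\operatorname{tp}(a_i/A\cup a_{<i})$ does not fork over $A$ for every $i$. Let $\equiv'_A$ be the transitive closure of the relation "$a,b$ start a Morley sequence over $A$, or $b,a$ start a Morley sequence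 over $A$", where $a,b$ *start* a sequence $(a_i)_{i<\omega}$ if $a_0=a$ and $a_1=b$. Write $a\equiv^{\mathrm L}_A b$ ($a$ and $b$ have the same *Lascar type* over $A$) if either of the following equivalent conditions holds: 1. $a$ and $b$ are equivalent under every $A$-invariant equivalence relation (that is, invariant under all automorphisms of $\mathbb{M}$ fixing $A$ pointwise) with a bounded number of classes; 2. there are $n<\omega$ and $a=a_0,\dots,a_n=b$ such that $a_i,a_{i+1}$ start an $A$-indiscernible sequence for each $i<n$. **Proposition.** If $p$ is extensible, then for all realizations $a,b$ of $p$ in $\mathbb{M}$, $$a\equiv^{\mathrm L}_A b\iff a\equiv'_A b ,$$ where $\equiv^{\mathrm L}_A$ may be read through (1) or through (2). -/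

import Mathlib

open FirstOrder Cardinal

universe u v w

namespace Forking

open FirstOrder.Language

section Types

variable (L : FirstOrder.Language.{u, v}) {M : Type w} [L.Structure M] [Nonempty M]

/-- `S_α(B)`: complete types over the parameter set `B ⊆ M` in the variables `(x_i)_{i : α}`. -/
abbrev TypeOver (B : Set M) (α : Type*) :=
  (L[[B]].completeTheory M).CompleteType α

/-- `tp(a / B)`. -/
abbrev tp {α : Type*} (a : α → M) (B : Set M) : TypeOver L B α :=
  (L[[B]].completeTheory M).typeOf a

end Types

section Monster

variable {L : FirstOrder.Language.{u, v}}

/-- `M` is a monster model of the complete theory `T`, of degree of saturation `κ`. A set or a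
tuple is *small*, and a number of classes is *bounded*, if it is `< κ`. The largeness condition
`κ = ℶ_κ` makes `κ` an uncountable strong limit with `ℶ_{(2^μ)⁺} < κ` for every `μ < κ`. -/
structure IsMonster (T : L.Theory) (κ : Cardinal.{w}) (M : Type w) [L.Structure M]
    [Nonempty M] : Prop where
  complete : T.IsComplete
  model : M ⊨ T
  large : ℶ_ κ.ord = κ
  language_small : Cardinal.lift.{w} L.card < Cardinal.lift.{max u v} κ
  /-- `κ`-saturation: types in a small tuple of variables over a small set are realized. -/
  saturated : ∀ B : Set M, #B < κ → ∀ ι : Type w, #ι < κ →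
    ∀ p : TypeOver L B ι, ∃ a : ι → M, tp L a B = p
  /-- Strong `κ`-homogeneity. -/
  homogeneous : ∀ ι : Type w, #ι < κ → ∀ a b : ι → M,
    (L.completeTheory M).typeOf a = (L.completeTheory M).typeOf b →
    ∃ σ : M ≃[L] M, ∀ i, σ (a i) = b i

end Monster

section Dividing

variable {L : FirstOrder.Language.{u, v}} {M : Type w} [L.Structure M] [Nonempty M] {α : Type*}

/-- The formula `φ(x, b)` with parameters `b` from `B`, where `φ(x, y)` is an `L`-formula. -/
noncomputable def instantiate {B : Set M} {n : ℕ} (φ : L.Formula (α ⊕ Fin n)) (b : Fin n → B) :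
    L[[B]].Formula α :=
  BoundedFormula.constantsVarsEquiv.symm
    (Formula.relabel (Sum.elim Sum.inr (Sum.inl ∘ b)) φ : L.Formula (B ⊕ α))

/-- `φ(x, b) ∈ p`, where `p` is a type over `B` and `b` is a tuple from `B`. -/
def Contains {B : Set M} (p : TypeOver L B α) {n : ℕ} (φ : L.Formula (α ⊕ Fin n))
    (b : Fin n → B) : Prop :=
  Formula.equivSentence (instantiate φ b) ∈ p

theorem contains_tp {B : Set M} (a : α → M) {n : ℕ} (φ : L.Formula (α ⊕ Fin n))
    (b : Fin n → B) :
    Contains (tp L a B) φ b ↔ φ.Realize (Sum.elim a (fun i => (b i : M))) := by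
  unfold Contains
  rw [Theory.CompleteType.formula_mem_typeOf]
  unfold instantiate Formula.Realize
  rw [← BoundedFormula.realize_constantsVarsEquiv, Equiv.apply_symm_apply]
  have h := Formula.realize_relabel (φ := φ)
    (g := (Sum.elim Sum.inr (Sum.inl ∘ b) : α ⊕ Fin n → B ⊕ α))
    (v := Sum.elim (fun c : B => ((L.con c : L[[B]].Constants) : M)) a)
  refine h.trans ?_
  have e : (Sum.elim (fun c : B => ((L.con c : L[[B]].Constants) : M)) a) ∘
      (Sum.elim Sum.inr (Sum.inl ∘ b)) = Sum.elim a (fun i => (b i : M)) := by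
    funext i
    rcases i with i | i
    · rfl
    · simp
  rw [e]
  rfl

/-- `φ(x, b)` divides over `A`: for some `k` there is a sequence `(b_i)_{i < ω}` of realizations of
`tp(b / A)` such that `{φ(x, b_i) : i < ω}` is `k`-inconsistent. -/
def Divides (A : Set M) {n : ℕ} (φ : L.Formula (α ⊕ Fin n)) (b : Fin n → M) : Prop :=
  ∃ (k : ℕ) (c : ℕ → Fin n → M), (∀ i, tp L (c i) A = tp L b A) ∧
    ∀ s : Finset ℕ, s.card = k → ¬ ∃ x : α → M, ∀ i ∈ s, φ.Realize (Sum.elim x (c i))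

/-- `φ(x, b)` forks over `A`: it implies a finite disjunction of formulas (with arbitrary parameters
from the monster model) each of which divides over `A`. -/
def Forks (A : Set M) {n : ℕ} (φ : L.Formula (α ⊕ Fin n)) (b : Fin n → M) : Prop :=
  ∃ (m : ℕ) (r : Fin m → ℕ) (ψ : ∀ j, L.Formula (α ⊕ Fin (r j))) (c : ∀ j, Fin (r j) → M),
    (∀ j, Divides A (ψ j) (c j)) ∧
    ∀ x : α → M, φ.Realize (Sum.elim x b) → ∃ j, (ψ j).Realize (Sum.elim x (c j))

/-- The complete type `p` over `B` forks over `A`, i.e. it contains (equivalently, being closed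
under finite conjunctions, implies) a formula that forks over `A`. -/
def TypeForks (A : Set M) {B : Set M} (p : TypeOver L B α) : Prop :=
  ∃ (n : ℕ) (φ : L.Formula (α ⊕ Fin n)) (b : Fin n → B),
    Contains p φ b ∧ Forks A φ (fun i => (b i : M))

/-- The type `p ∈ S(A)` is extensible: it has a global extension that does not fork over `A`. -/
def Extensible {A : Set M} (p : TypeOver L A α) : Prop :=
  ∃ q : TypeOver L (Set.univ : Set M) α,
    (∀ (n : ℕ) (φ : L.Formula (α ⊕ Fin n)) (b : Fin n → A),
      Contains p φ b → Contains q φ (fun i => ⟨(b i : M), trivial⟩)) ∧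
    ¬ TypeForks A q

end Dividing

section Sequences

variable (L : FirstOrder.Language.{u, v}) {M : Type w} [L.Structure M] [Nonempty M] {α : Type*}

/-- The sequence of `α`-tuples `(a_i)_{i < ω}` is indiscernible over `A`. -/
def Indiscernible (A : Set M) (a : ℕ → α → M) : Prop :=
  ∀ (n : ℕ) (i j : Fin n → ℕ), StrictMono i → StrictMono j →
    tp L (fun s : Fin n × α => a (i s.1) s.2) A = tp L (fun s : Fin n × α => a (j s.1) s.2) A

/-- `(a_i)_{i < ω}` is a Morley sequence over `A`: it is indiscernible over `A`, and
`tp(a_i / A a_{<i})` does not fork over `A` for every `i`. -/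
def IsMorley (A : Set M) (a : ℕ → α → M) : Prop :=
  Indiscernible L A a ∧
    ∀ i, ¬ TypeForks A (tp L (a i) (A ∪ {c | ∃ j < i, c ∈ Set.range (a j)}))

/-- `a, b` start an indiscernible sequence over `A`. -/
def StartIndiscernible (A : Set M) (a b : α → M) : Prop :=
  ∃ s : ℕ → α → M, Indiscernible L A s ∧ s 0 = a ∧ s 1 = b

/-- `a, b` start a Morley sequence over `A`. -/
def StartMorley (A : Set M) (a b : α → M) : Prop :=
  ∃ s : ℕ → α → M, IsMorley L A s ∧ s 0 = a ∧ s 1 = b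

/-- `a ≡'_A b`: the transitive closure of the relation "`a, b` start a Morley sequence over `A`, or
`b, a` start a Morley sequence over `A`". -/
def MorleyEquiv (A : Set M) : (α → M) → (α → M) → Prop :=
  Relation.TransGen fun a b => StartMorley L A a b ∨ StartMorley L A b a

/-- The equivalence relation `E` on `α`-tuples is invariant under automorphisms fixing `A`
pointwise. -/
def InvariantOver (A : Set M) (E : Setoid (α → M)) : Prop :=
  ∀ σ : M ≃[L] M, (∀ c ∈ A, σ c = c) → ∀ a b : α → M, E a b → E (σ ∘ a) (σ ∘ b)

end Sequences

section Lascar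

variable (L : FirstOrder.Language.{u, v}) {M : Type w} [L.Structure M] [Nonempty M] {α : Type w}

/-- `a ≡^L_A b`, through equivalence relations: `a` and `b` are equivalent under every
`A`-invariant equivalence relation with a bounded number of classes. -/
def LascarEquiv (κ : Cardinal.{w}) (A : Set M) (a b : α → M) : Prop :=
  ∀ E : Setoid (α → M), InvariantOver L A E → #(Quotient E) < κ → E a b

/-- `a ≡^L_A b`, through chains: there are `a = a_0, …, a_n = b` such that `a_i, a_{i+1}` start an
indiscernible sequence over `A` for each `i < n`. -/
def LascarChain (A : Set M) (a b : α → M) : Prop :=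
  ∃ (n : ℕ) (c : ℕ → α → M), c 0 = a ∧ c n = b ∧
    ∀ i < n, StartIndiscernible L A (c i) (c (i + 1))

end Lascar

end Forking

/-! One direction is soft: Morley sequences are indiscernible, and an indiscernible sequence can be
reversed, so a `≡'_A`-chain is a Lascar chain. An indiscernible sequence can be stretched beyond the
number of classes of a bounded invariant equivalence relation; two of its terms are then equivalent,
and by homogeneity so are the first two.

The heart of the converse is that if `s` is `A`-indiscernible and `s 0` realizes `p`, then `s 0` and
`s 1` can be continued by one and the same Morley tail (`exists_common_morley`), which makes them
`≡'_A`-equivalent in two steps. Extensibility supplies a Morley sequence `c` starting at `s 0`: take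
nonforking realizations of `p` over everything chosen so far, for long enough, and extract an
indiscernible sequence. Its tail is then replaced, one term at a time, by terms over which `s` stays
indiscernible, without changing the type over `A` of the tail together with `s 0`. All `s i` then
have the same type over `A` and the new tail, so each of them followed by that tail is a conjugate
of `c`.

One such replacement (`exists_indiscernible_over`) combines two facts. Nonforking implies
nondividing, so the conjugates of the type of the next term along a stretched copy of `s` have a
common realization. The stretched copy can be taken long enough for the Erdős–Rado theorem to
extract a sequence indiscernible over that realization.

This handles chains. For invariant equivalence relations, extend `≡'_A` on `p` by one more class.
The result is `A`-invariant, and it has boundedly many classes: among too many representatives,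
extraction finds two that start an indiscernible sequence, and these are equivalent by the previous
step. -/

namespace Forking

set_option linter.unusedSectionVars false

/-! ### Partition calculus: the Erdős–Rado theorem and coherent colours. -/

section ErdosRado

open Classical in
/-- The greedy branch towards `x` in the ramification tree of a colouring `f`. -/
noncomputable def greedyBranch {X C I : Type*} [LinearOrder I] [WellFoundedLT I]
    (f : Finset X → C) (x : X) : I → X :=
  haveI : Nonempty X := ⟨x⟩
  (wellFounded_lt (α := I)).fix fun i y => Classical.epsilon fun z =>
    (∀ (j : I) (h : j < i), z ≠ y j h) ∧ ∀ s : Finset (Set.Iio i),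
      f (insert z (s.image fun j => y j.1 j.2)) = f (insert x (s.image fun j => y j.1 j.2))

open Classical in
theorem greedyBranch_eq {X C I : Type*} [LinearOrder I] [WellFoundedLT I]
    (f : Finset X → C) (x : X) (i : I) :
    haveI : Nonempty X := ⟨x⟩
    greedyBranch f x i = Classical.epsilon fun z =>
      (∀ j : I, j < i → z ≠ greedyBranch f x j) ∧ ∀ s : Finset (Set.Iio i),
        f (insert z (s.image fun j => greedyBranch f x j.1)) =
          f (insert x (s.image fun j => greedyBranch f x j.1)) := by
  unfold greedyBranch
  rw [WellFounded.fix_eq]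

-- If the greedy branch towards some `x` never meets `x`, then `x` is a legitimate candidate at
-- every stage, so the choices succeed and the branch is as required. Otherwise every `x` is met at
-- some stage. That stage and the colours of `x` over the earlier part of its branch determine the
-- branch, hence `x`; but there are at most `2 ^ θ` such codes.
open Classical in
theorem exists_endHomogeneous {X C I : Type w} [LinearOrder I] [WellFoundedLT I]
    {θ : Cardinal.{w}} (hθ : ℵ₀ ≤ θ) (hI : ∀ i : I, #(Set.Iio i) ≤ θ) (hI' : #I ≤ 2 ^ θ)
    (hC : #C ≤ 2 ^ θ) (hX : 2 ^ θ < #X) (f : Finset X → C) :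
    ∃ (y : I → X) (x : X), Function.Injective y ∧ ∀ (i : I) (s : Finset I), (∀ j ∈ s, j < i) →
      f (insert (y i) (s.image y)) = f (insert x (s.image y)) := by
  by_cases h : ∃ x, ∀ i : I, greedyBranch f x i ≠ x
  · obtain ⟨x, hx⟩ := h
    have key : ∀ i : I, (∀ j : I, j < i → greedyBranch f x i ≠ greedyBranch f x j) ∧
        ∀ s : Finset (Set.Iio i),
        f (insert (greedyBranch f x i) (s.image fun j => greedyBranch f x j.1)) =
          f (insert x (s.image fun j => greedyBranch f x j.1)) := by
      intro i
      have : Nonempty X := ⟨x⟩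
      have := Classical.epsilon_spec (p := fun z =>
        (∀ j : I, j < i → z ≠ greedyBranch f x j) ∧ ∀ s : Finset (Set.Iio i),
        f (insert z (s.image fun j => greedyBranch f x j.1)) =
          f (insert x (s.image fun j => greedyBranch f x j.1)))
        ⟨x, fun j _ => (hx j).symm, fun s => rfl⟩
      rw [← greedyBranch_eq] at this
      exact this
    refine ⟨greedyBranch f x, x, ?_, ?_⟩
    · intro i j hij
      rcases lt_trichotomy i j with h | h | h
      · exact absurd hij.symm ((key j).1 i h)
      · exact h
      · exact absurd hij ((key i).1 j h)
    · intro i s hs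
      have e : s.image (greedyBranch f x) =
          (s.subtype (· ∈ Set.Iio i)).image fun j => greedyBranch f x j.1 := by
        ext z
        simp only [Finset.mem_image, Finset.mem_subtype, Subtype.exists, Set.mem_Iio]
        constructor
        · rintro ⟨j, hj, rfl⟩
          exact ⟨j, hs j hj, hj, rfl⟩
        · rintro ⟨j, _, hj, rfl⟩
          exact ⟨j, hj, rfl⟩
      rw [e]
      exact (key i).2 _
  · exfalso
    push Not at h
    choose i hi using h
    let code : X → Σ i : I, (Finset (Set.Iio i) → C) := fun x =>
      ⟨i x, fun s => f (insert x (s.image fun j => greedyBranch f x j.1))⟩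
    have hinj : Function.Injective code := by
      intro x x' hxx
      have hii : i x = i x' := congrArg Sigma.fst hxx
      -- Equal codes agree below every earlier stage. Quantifying over both pairs avoids
      -- transporting the dependent second component along the equality of the first ones.
      have hG : ∀ p q : Σ i : I, (Finset (Set.Iio i) → C), p = q → ∀ (j : I) (hj : j ≤ p.1)
          (hj' : j ≤ q.1) (s : Finset (Set.Iio j)),
          p.2 (s.image fun k => ⟨k.1, k.2.trans_le hj⟩) =
            q.2 (s.image fun k => ⟨k.1, k.2.trans_le hj'⟩) := by
        rintro p _ rfl j hj hj' s; rfl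
      have hy : ∀ j : I, j ≤ i x → greedyBranch f x j = greedyBranch f x' j := by
        intro j
        induction j using (wellFounded_lt (α := I)).induction with
        | _ j ih =>
        intro hj
        have e : ∀ s : Finset (Set.Iio j), (s.image fun k => greedyBranch f x k.1) =
            s.image fun k => greedyBranch f x' k.1 := fun s =>
          Finset.image_congr fun k _ => ih k.1 k.2 (k.2.le.trans hj)
        have hGs : ∀ s : Finset (Set.Iio j),
            f (insert x (s.image fun k => greedyBranch f x k.1)) =
            f (insert x' (s.image fun k => greedyBranch f x' k.1)) := by
          intro s
          have := hG _ _ hxx j hj (hj.trans_eq hii) s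
          simpa only [code, Finset.image_image, Function.comp_def] using this
        rw [greedyBranch_eq, greedyBranch_eq]
        congr 1
        funext z
        apply propext
        refine and_congr (forall_congr' fun k => forall_congr' fun hk => ?_)
          (forall_congr' fun s => ?_)
        · rw [ih k hk (hk.le.trans hj)]
        · rw [hGs s, e s]
      rw [← hi x, hy _ le_rfl, hii, hi x']
    have h1 := Cardinal.mk_le_of_injective hinj
    have h2 : #(Σ i : I, (Finset (Set.Iio i) → C)) ≤ 2 ^ θ := by
      rw [Cardinal.mk_sigma]
      have h3 : ∀ i : I, #(Finset (Set.Iio i) → C) ≤ 2 ^ θ := by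
        intro i
        rw [← Cardinal.power_def]
        have hfin : #(Finset (Set.Iio i)) ≤ θ := by
          refine (Cardinal.mk_le_of_surjective (List.toFinset_surjective)).trans ?_
          exact (Cardinal.mk_list_le_max _).trans (max_le hθ (hI i))
        calc #C ^ #(Finset (Set.Iio i)) ≤ (2 ^ θ) ^ #(Finset (Set.Iio i)) :=
              Cardinal.power_le_power_right hC
          _ ≤ (2 ^ θ) ^ θ := Cardinal.power_le_power_left
              (Cardinal.power_ne_zero _ two_ne_zero) hfin
          _ = 2 ^ θ := by rw [← Cardinal.power_mul, Cardinal.mul_eq_self hθ]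
      refine (Cardinal.sum_le_sum _ _ h3).trans ?_
      rw [Cardinal.sum_const']
      refine (mul_le_mul_left hI' _).trans ?_
      rw [Cardinal.mul_eq_self (hθ.trans (Cardinal.cantor θ).le)]
    exact absurd (h1.trans h2) hX.not_ge

open Classical in
/-- The Erdős–Rado theorem `ℶ_{ξ + n}⁺ → (ℶ_ξ⁺)^n_{ℶ_ξ}` (for `n ≥ 1`). -/
theorem exists_homogeneous (n : ℕ) (ξ : Ordinal.{w}) : ∀ {X C : Type w}, #C ≤ ℶ_ ξ →
    ℶ_ (ξ + n) < #X → ∀ f : Finset X → C, ∃ (Y : Set X) (t : C), ℶ_ ξ < #Y ∧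
      ∀ s : Finset X, ↑s ⊆ Y → s.card = n → f s = t := by
  induction n with
  | zero =>
    intro X C _ hX f
    refine ⟨Set.univ, f ∅, by simpa using hX, fun s _ hs => ?_⟩
    rw [Finset.card_eq_zero.1 hs]
  | succ n ih =>
    intro X C hC hX f
    set θ := ℶ_ (ξ + n) with hθ
    have hX' : 2 ^ θ < #X := by
      rw [hθ, ← Cardinal.beth_add_one, add_assoc]
      exact_mod_cast hX
    have h0 : ℵ₀ ≤ θ := Cardinal.aleph0_le_beth _
    -- Order type `θ⁺` keeps proper initial segments of size at most `θ`, while the whole exceeds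
    -- `ℶ_ (ξ + n)`, as the induction hypothesis needs.
    obtain ⟨y, x, hy, hend⟩ := exists_endHomogeneous (I := (Order.succ θ).ord.ToType) h0
      (fun i => by
        have : #(Set.Iio i) < Order.succ θ := by
          simpa using Cardinal.mk_Iio_lt i (by simp)
        exact Order.lt_succ_iff.1 this)
      (by simpa using Order.succ_le_of_lt (Cardinal.cantor θ))
      (hC.trans ((Cardinal.beth_le_beth.2 (by simp)).trans (Cardinal.cantor θ).le)) hX' f
    obtain ⟨J, t, hJ, hJt⟩ := ih hC (X := (Order.succ θ).ord.ToType) (by simp [hθ])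
      (fun s => f (insert x (s.image y)))
    refine ⟨y '' J, t, by rwa [Cardinal.mk_image_eq hy], fun s hs hcard => ?_⟩
    obtain ⟨s', hs', rfl⟩ := (Finset.subset_set_image_iff).1 hs
    rw [Finset.card_image_of_injective _ hy] at hcard
    have hne : s'.Nonempty := Finset.card_pos.1 (by omega)
    set m := s'.max' hne
    have hm : m ∈ s' := s'.max'_mem hne
    -- End-homogeneity replaces the largest element by `x`, leaving the induced colouring of an
    -- `n`-element set.
    rw [← Finset.insert_erase hm, Finset.image_insert, hend m (s'.erase m)]
    · refine hJt _ (fun j hj => hs' (Finset.mem_of_mem_erase hj)) ?_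
      rw [Finset.card_erase_of_mem hm]; omega
    · intro j hj
      exact lt_of_le_of_ne (s'.le_max' j (Finset.mem_of_mem_erase hj)) (Finset.ne_of_mem_erase hj)

/-- A sequence can be built step by step subject to conditions on its initial segments. -/
theorem exists_seq_of_step {X : Type*} [Nonempty X] (P : ℕ → (ℕ → X) → Prop)
    (hloc : ∀ n u v, (∀ k < n, u k = v k) → P n u → P n v) (h0 : ∀ u, P 0 u)
    (hs : ∀ n u, P n u → ∃ x, P (n + 1) (Function.update u n x)) : ∃ u, ∀ n, P n u := by
  classical
  choose! g hg using hs
  let U : ℕ → ℕ → X := fun n => Nat.rec (fun _ => Classical.arbitrary X)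
    (fun n u => Function.update u n (g n u)) n
  have hU : ∀ n, P n (U n) := by
    intro n
    induction n with
    | zero => exact h0 _
    | succ n ih => exact hg n _ ih
  have hst : ∀ m n, n ≤ m → ∀ k < n, U m k = U n k := by
    intro m
    induction m with
    | zero => intro n hn k hk; omega
    | succ m ih =>
      intro n hn k hk
      rcases Nat.lt_or_ge m n with h | h
      · obtain rfl : n = m + 1 := by omega
        rfl
      · rw [← ih n h k hk]
        exact Function.update_of_ne (by omega) _ _
  refine ⟨fun k => U (k + 1) k, fun n => hloc n (U n) _ (fun k hk => ?_) (hU n)⟩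
  exact (hst n (k + 1) hk k (Nat.lt_succ_self k))

/-- Any colouring of the finite subsets of a sufficiently large set has a coherent sequence of
colours with arbitrarily large homogeneous sets. -/
theorem exists_coherent_colours {X C : Type w} (f : Finset X → C) (ν : Cardinal.{w})
    (hν : ℵ₀ ≤ ν) (hC : #C ≤ ν) (hX : ℶ_ (Order.succ ν).ord ≤ #X) :
    ∃ t : ℕ → C, ∀ N : ℕ, ∃ s : Finset X, s.card = N ∧ ∀ r ⊆ s, f r = t r.card := by
  have : Nonempty C := ⟨f ∅⟩
  let P : ℕ → (ℕ → C) → Prop := fun n t => ∀ ξ < (Order.succ ν).ord, ∃ Y : Set X, ℶ_ ξ ≤ #Y ∧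
    ∀ s : Finset X, ↑s ⊆ Y → s.card < n → f s = t s.card
  have hreg : (Order.succ ν).IsRegular := Cardinal.isRegular_succ hν
  obtain ⟨t, ht⟩ := exists_seq_of_step P
    (by
      intro n u v huv h ξ hξ
      obtain ⟨Y, hY, hs⟩ := h ξ hξ
      exact ⟨Y, hY, fun s hsY hn => (hs s hsY hn).trans (huv _ hn)⟩)
    (fun u ξ hξ => ⟨Set.univ, by
      simpa using (Cardinal.beth_le_beth.2 hξ.le).trans hX, fun s _ h => absurd h (by simp)⟩)
    (by
      intro n u h
      by_contra hcon
      push Not at hcon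
      have hcon' : ∀ x : C, ∃ ξ < (Order.succ ν).ord, ∀ Y : Set X, ℶ_ ξ ≤ #Y →
          ∃ s : Finset X, ↑s ⊆ Y ∧ s.card < n + 1 ∧ f s ≠ Function.update u n x s.card := by
        intro x
        have := hcon x
        simp only [P] at this
        push Not at this
        exact this
      choose ξ hξ hbad using hcon'
      -- If each colour fails at some level below `ν⁺`, regularity bounds these levels, as there are
      -- at most `ν` colours. A homogeneous set above the bound then refutes its own colour. The
      -- term `ν.ord` ensures `#C ≤ ℶ_ η`.
      let η : Ordinal.{w} := max ν.ord (⨆ x, ξ x)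
      have hη : η < (Order.succ ν).ord := by
        refine max_lt (Cardinal.ord_lt_ord.2 (Order.lt_succ ν)) ?_
        refine Ordinal.iSup_lt_of_lt_cof ?_ hξ
        rw [hreg.cof_ord]
        exact Order.lt_succ_of_le hC
      have hlim : Order.IsSuccLimit (Order.succ ν).ord :=
        Cardinal.isSuccLimit_ord (hν.trans (Order.le_succ ν))
      have hη' : η + n + 1 < (Order.succ ν).ord := by
        have : ∀ k : ℕ, η + k < (Order.succ ν).ord := by
          intro k
          induction k with
          | zero => simpa using hη
          | succ k ih => simpa [← add_assoc] using hlim.succ_lt ih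
        simpa [← add_assoc] using this (n + 1)
      obtain ⟨Y, hY, hs⟩ := h _ hη'
      obtain ⟨Z, x, hZ, hx⟩ := exists_homogeneous n η (X := Y) (C := C)
        (hC.trans ((Cardinal.le_beth_ord ν).trans (Cardinal.beth_le_beth.2 (le_max_left _ _))))
        (lt_of_lt_of_le (Cardinal.beth_lt_beth.2 (by simp)) hY)
        (fun s => f (s.map (Function.Embedding.subtype _)))
      obtain ⟨s, hsZ, hsn, hfs⟩ := hbad x (Subtype.val '' Z) (by
        rw [Cardinal.mk_image_eq Subtype.val_injective]
        refine (Cardinal.beth_le_beth.2 ?_).trans hZ.le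
        exact (Ordinal.le_iSup ξ x).trans (le_max_right _ _))
      apply hfs
      rcases Nat.lt_succ_iff_lt_or_eq.1 hsn with h1 | h1
      · rw [Function.update_of_ne h1.ne]
        exact hs s (hsZ.trans (by rintro _ ⟨z, _, rfl⟩; exact z.2)) h1
      · rw [h1, Function.update_self]
        classical
        obtain ⟨s', hs', rfl⟩ := (Finset.subset_set_image_iff).1 hsZ
        have := hx s' hs' (by rwa [Finset.card_image_of_injective _ Subtype.val_injective] at h1)
        rwa [Finset.map_eq_image] at this)
  refine ⟨t, fun N => ?_⟩
  obtain ⟨Y, hY, hs⟩ := ht (N + 1) 0 (by simp [Cardinal.lt_ord])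
  have hinf : Y.Infinite := by
    rw [← Set.infinite_coe_iff, Cardinal.infinite_iff]
    simpa using hY
  obtain ⟨s, hsY, hsN⟩ := hinf.exists_subset_card_eq N
  refine ⟨s, hsN, fun r hr => hs r ((Finset.coe_subset.2 hr).trans hsY) ?_⟩
  have := Finset.card_le_card hr
  omega

end ErdosRado

open FirstOrder.Language

/-! ### Types through formulas with parameters as variables. -/

section Basics

variable {L : FirstOrder.Language.{u, v}} {M : Type w} [L.Structure M] [Nonempty M]

/-- The `L`-formula `ψ(b, x)`, with a variable for each element of `B`, as an `L[[B]]`-formula. -/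
noncomputable def substParams {B : Set M} {ι : Type*} (ψ : L.Formula (B ⊕ ι)) : L[[B]].Formula ι :=
  BoundedFormula.constantsVarsEquiv.symm ψ

theorem realize_substParams {B : Set M} {ι : Type*} (ψ : L.Formula (B ⊕ ι)) (a : ι → M) :
    (substParams ψ).Realize a ↔ ψ.Realize (Sum.elim (fun b : B => (b : M)) a) := by
  unfold substParams Formula.Realize
  rw [← BoundedFormula.realize_constantsVarsEquiv, Equiv.apply_symm_apply]
  rfl

theorem mem_tp_iff {B : Set M} {ι : Type*} (ψ : L.Formula (B ⊕ ι)) (a : ι → M) :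
    Formula.equivSentence (substParams ψ) ∈ tp L a B ↔
      ψ.Realize (Sum.elim (fun b : B => (b : M)) a) := by
  rw [Theory.CompleteType.formula_mem_typeOf, realize_substParams]

theorem exists_eq_equivSentence_substParams {B : Set M} {ι : Type*} (φ : L[[B]][[ι]].Sentence) :
    ∃ ψ : L.Formula (B ⊕ ι), φ = Formula.equivSentence (substParams ψ) :=
  ⟨BoundedFormula.constantsVarsEquiv (Formula.equivSentence.symm φ), by simp [substParams]⟩

theorem tp_eq_iff {B : Set M} {ι : Type*} {a b : ι → M} :
    tp L a B = tp L b B ↔ ∀ ψ : L.Formula (B ⊕ ι),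
      ψ.Realize (Sum.elim (fun b : B => (b : M)) a) ↔
        ψ.Realize (Sum.elim (fun b : B => (b : M)) b) := by
  constructor
  · intro h ψ
    rw [← mem_tp_iff, h, mem_tp_iff]
  · intro h
    apply SetLike.ext
    intro φ
    obtain ⟨ψ, rfl⟩ := exists_eq_equivSentence_substParams φ
    rw [mem_tp_iff, mem_tp_iff, h]

theorem tp_eq_of_imp {B : Set M} {ι : Type*} {a b : ι → M}
    (h : ∀ ψ : L.Formula (B ⊕ ι), ψ.Realize (Sum.elim (fun b : B => (b : M)) a) →
        ψ.Realize (Sum.elim (fun b : B => (b : M)) b)) : tp L a B = tp L b B := by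
  refine tp_eq_iff.2 fun ψ => ⟨h ψ, fun hb => ?_⟩
  by_contra ha
  have := h ψ.not (by rwa [Formula.realize_not])
  rw [Formula.realize_not] at this
  exact this hb

theorem tp_comp_params {B : Set M} {ι ι' : Type*} {a b : ι → M} (h : tp L a B = tp L b B)
    (g : ι' → B ⊕ ι) :
    tp L (Sum.elim (fun b : B => (b : M)) a ∘ g) B =
      tp L (Sum.elim (fun b : B => (b : M)) b ∘ g) B := by
  rw [tp_eq_iff] at h ⊢
  intro ψ
  have := h (ψ.relabel (Sum.elim Sum.inl g))
  simpa only [Formula.realize_relabel, Sum.comp_elim, Sum.elim_comp_inl] using this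

theorem tp_comp {B : Set M} {ι ι' : Type*} {a b : ι → M} (h : tp L a B = tp L b B) (g : ι' → ι) :
    tp L (a ∘ g) B = tp L (b ∘ g) B :=
  tp_comp_params h (Sum.inr ∘ g)

theorem eq_of_tp_eq {B : Set M} {ι : Type*} {a b : ι → M} (h : tp L a B = tp L b B) {i j : ι}
    (hij : a i = a j) : b i = b j := by
  have := tp_eq_iff.1 h ((Term.var (Sum.inr i)).equal (Term.var (Sum.inr j)))
  simpa [Formula.realize_equal, hij] using this

theorem realize_automorphism (σ : M ≃[L] M) {A : Set M} (hσ : ∀ c ∈ A, σ c = c) {ι : Type*}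
    (ψ : L.Formula (A ⊕ ι)) (a : ι → M) :
    ψ.Realize (Sum.elim (fun b : A => (b : M)) (σ ∘ a)) ↔
      ψ.Realize (Sum.elim (fun b : A => (b : M)) a) := by
  have h := StrongHomClass.realize_formula σ ψ (v := Sum.elim (fun b : A => (b : M)) a)
  have : (σ ∘ fun b : A => (b : M)) = fun b : A => (b : M) := funext fun b => hσ b b.2
  rwa [Sum.comp_elim, this] at h

theorem tp_automorphism (σ : M ≃[L] M) {A : Set M} (hσ : ∀ c ∈ A, σ c = c) {ι : Type*}
    (a : ι → M) : tp L (σ ∘ a) A = tp L a A :=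
  tp_eq_iff.2 fun ψ => realize_automorphism σ hσ ψ a

theorem symm_fixes (σ : M ≃[L] M) {A : Set M} (hσ : ∀ c ∈ A, σ c = c) :
    ∀ c ∈ A, σ.symm c = c := by
  intro c hc
  conv_lhs => rw [← hσ c hc]
  exact σ.symm_apply_apply c

/-- A formula depends on finitely many parameters. -/
theorem exists_finite_params {P ι : Type*} (ψ : L.Formula (P ⊕ ι)) :
    ∃ (n : ℕ) (φ : L.Formula (ι ⊕ Fin n)) (g : Fin n → P), ∀ (v : P → M) (x : ι → M),
      φ.Realize (Sum.elim x (v ∘ g)) ↔ ψ.Realize (Sum.elim v x) := by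
  classical
  let F : Finset P := (BoundedFormula.freeVarFinset ψ).toLeft
  let f : BoundedFormula.freeVarFinset ψ → ι ⊕ Fin F.card := fun x => match x with
    | ⟨Sum.inl p, h⟩ => Sum.inr (F.equivFin ⟨p, Finset.mem_toLeft.2 h⟩)
    | ⟨Sum.inr i, _⟩ => Sum.inl i
  refine ⟨F.card, BoundedFormula.restrictFreeVar ψ f, fun k => (F.equivFin.symm k : P),
    fun v x => ?_⟩
  refine BoundedFormula.realize_restrictFreeVar _ ?_
  rintro ⟨p | i, h⟩
  · simp [f]
  · simp [f]

end Basics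

/-! ### Homogeneity, compactness and counting types in the monster model. -/

section Monster

variable {L : FirstOrder.Language.{u, v}} {T : L.Theory} {κ : Cardinal.{w}} {M : Type w}
  [L.Structure M] [Nonempty M]

theorem IsMonster.isStrongLimit (hM : IsMonster T κ M) : κ.IsStrongLimit := by
  rw [← hM.large, Cardinal.isStrongLimit_beth]
  have h0 : ℵ₀ ≤ κ := by rw [← hM.large]; exact Cardinal.aleph0_le_beth _
  exact (Cardinal.isSuccLimit_ord h0).isSuccPrelimit

theorem IsMonster.aleph0_lt (hM : IsMonster T κ M) : ℵ₀ < κ := by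
  have h0 : ℵ₀ ≤ κ := hM.isStrongLimit.aleph0_le
  rw [← hM.large, ← Cardinal.beth_zero]
  refine Cardinal.beth_lt_beth.2 ?_
  rw [Cardinal.lt_ord]
  simpa using (Cardinal.aleph0_pos.trans_le h0)

theorem IsMonster.mk_sum_lt (hM : IsMonster T κ M) {P ι : Type w} (hP : #P < κ) (hι : #ι < κ) :
    #(P ⊕ ι) < κ := by
  rw [Cardinal.mk_sum, Cardinal.lift_id, Cardinal.lift_id]
  exact Cardinal.add_lt_of_lt hM.aleph0_lt.le hP hι

theorem IsMonster.mk_prod_lt (hM : IsMonster T κ M) {P ι : Type w} (hP : #P < κ) (hι : #ι < κ) :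
    #(P × ι) < κ := by
  rw [Cardinal.mk_prod, Cardinal.lift_id, Cardinal.lift_id]
  exact Cardinal.mul_lt_of_lt hM.aleph0_lt.le hP hι

theorem IsMonster.mk_fin_prod_lt (hM : IsMonster T κ M) {ι : Type w} (hι : #ι < κ) (n : ℕ) :
    #(Fin n × ι) < κ := by
  have := hM.mk_prod_lt (P := ULift.{w} (Fin n)) (by
    refine lt_of_lt_of_le (Cardinal.lt_aleph0_of_finite _) hM.aleph0_lt.le) hι
  refine lt_of_eq_of_lt ?_ this
  exact Cardinal.mk_congr (Equiv.prodCongr Equiv.ulift.symm (Equiv.refl _))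

theorem IsMonster.mk_nat_prod_lt (hM : IsMonster T κ M) {ι : Type w} (hι : #ι < κ) :
    #(ℕ × ι) < κ := by
  have := hM.mk_prod_lt (P := ULift.{w} ℕ) (by simpa using hM.aleph0_lt) hι
  refine lt_of_eq_of_lt ?_ this
  exact Cardinal.mk_congr (Equiv.prodCongr Equiv.ulift.symm (Equiv.refl _))

/-- Tuples with the same type over a small set `A` are conjugate over `A`. -/
theorem IsMonster.exists_automorphism (hM : IsMonster T κ M) {A : Set M} (hA : #A < κ)
    {ι : Type w} (hι : #ι < κ) {a b : ι → M} (h : tp L a A = tp L b A) :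
    ∃ σ : M ≃[L] M, (∀ c ∈ A, σ c = c) ∧ σ ∘ a = b := by
  obtain ⟨σ, hσ⟩ := hM.homogeneous (A ⊕ ι) (hM.mk_sum_lt hA hι)
    (Sum.elim (fun c : A => (c : M)) a) (Sum.elim (fun c : A => (c : M)) b) (by
      apply SetLike.ext
      intro φ
      rw [Theory.CompleteType.mem_typeOf, Theory.CompleteType.mem_typeOf]
      exact tp_eq_iff.1 h _)
  exact ⟨σ, fun c hc => hσ (Sum.inl ⟨c, hc⟩), funext fun i => hσ (Sum.inr i)⟩

/-- Compactness for small sets of formulas with small parameter sets inside the monster model. -/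
theorem IsMonster.exists_realization (hM : IsMonster T κ M) {P ι : Type w} (hP : #P < κ)
    (hι : #ι < κ) (v : P → M) (Γ : Set (L.Formula (P ⊕ ι)))
    (h : ∀ s : Finset (L.Formula (P ⊕ ι)), ↑s ⊆ Γ →
      ∃ x : ι → M, ∀ ψ ∈ s, ψ.Realize (Sum.elim v x)) :
    ∃ x : ι → M, ∀ ψ ∈ Γ, ψ.Realize (Sum.elim v x) := by
  classical
  let B : Set M := Set.range v
  have hB : #B < κ := Cardinal.mk_range_le.trans_lt hP
  let c : L.Formula (P ⊕ ι) → L[[B]][[ι]].Sentence := fun ψ =>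
    Formula.equivSentence (substParams (ψ.relabel (Sum.map (Set.rangeFactorization v) id)))
  have hc : ∀ ψ (x : ι → M), c ψ ∈ tp L x B ↔ ψ.Realize (Sum.elim v x) := by
    intro ψ x
    rw [mem_tp_iff, Formula.realize_relabel, Sum.elim_comp_map]
    rfl
  have hsat : ((L[[B]].lhomWithConstants ι).onTheory (L[[B]].completeTheory M) ∪
      c '' Γ).IsSatisfiable := by
    rw [Theory.isSatisfiable_iff_isFinitelySatisfiable]
    intro T0 hT0
    have : ∃ s : Finset (L.Formula (P ⊕ ι)), ↑s ⊆ Γ ∧ ∀ φ ∈ T0,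
        φ ∈ (L[[B]].lhomWithConstants ι).onTheory (L[[B]].completeTheory M) ∨ φ ∈ c '' s := by
      have h1 : ∀ φ : T0, ∃ s : Finset (L.Formula (P ⊕ ι)), ↑s ⊆ Γ ∧
          ((φ : L[[B]][[ι]].Sentence) ∈
            (L[[B]].lhomWithConstants ι).onTheory (L[[B]].completeTheory M) ∨
            (φ : L[[B]][[ι]].Sentence) ∈ c '' s) := by
        rintro ⟨φ, hφ⟩
        rcases hT0 hφ with h2 | ⟨ψ, hψ, rfl⟩
        · exact ⟨∅, by simp, Or.inl h2⟩
        · exact ⟨{ψ}, by simpa using hψ, Or.inr ⟨ψ, by simp, rfl⟩⟩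
      choose s hs hs' using h1
      refine ⟨Finset.univ.biUnion s, ?_, fun φ hφ => ?_⟩
      · intro ψ hψ
        simp only [Finset.coe_biUnion, Set.mem_iUnion] at hψ
        obtain ⟨i, _, hi⟩ := hψ
        exact hs i hi
      · rcases hs' ⟨φ, hφ⟩ with h2 | ⟨ψ, hψ, h3⟩
        · exact Or.inl h2
        · refine Or.inr ⟨ψ, ?_, h3⟩
          simp only [Finset.coe_biUnion, Set.mem_iUnion]
          exact ⟨⟨φ, hφ⟩, by simp, hψ⟩
    obtain ⟨s, hs, hs'⟩ := this
    obtain ⟨x, hx⟩ := h s hs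
    refine (tp L x B).isMaximal.1.mono ?_
    intro φ hφ
    rcases hs' φ hφ with h2 | ⟨ψ, hψ, rfl⟩
    · exact (tp L x B).subset h2
    · exact (hc ψ x).2 (hx ψ hψ)
  have hne : {p : TypeOver L B ι | c '' Γ ⊆ ↑p} ≠ ∅ := fun he =>
    (Theory.CompleteType.setOfPred_subset_eq_empty_iff _).1 he hsat
  obtain ⟨p, hp⟩ := Set.nonempty_iff_ne_empty.2 hne
  obtain ⟨x, rfl⟩ := hM.saturated B hB ι hι p
  exact ⟨x, fun ψ hψ => (hc ψ x).1 (hp ⟨ψ, hψ, rfl⟩)⟩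

/-- Finitely many formulas of a global type have a common realization. -/
theorem exists_realization_of_mem {α : Type*} (q : TypeOver L (Set.univ : Set M) α)
    (s : Finset (L.Formula ((Set.univ : Set M) ⊕ α)))
    (hs : ∀ ψ ∈ s, Formula.equivSentence (substParams ψ) ∈ q) :
    ∃ x : α → M, ∀ ψ ∈ s, ψ.Realize (Sum.elim (fun b : (Set.univ : Set M) => (b : M)) x) := by
  classical
  let χ : L[[(Set.univ : Set M)]].Formula α := Formula.iInf fun ψ : s => substParams ψ.1
  have hχ : Formula.equivSentence χ ∈ q := by
    refine q.isMaximal.mem_of_models ?_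
    rw [Theory.models_sentence_iff]
    intro N
    let := (L[[(Set.univ : Set M)]].lhomWithConstants α).reduct N
    rw [Formula.realize_equivSentence, Formula.realize_iInf]
    rintro ⟨ψ, hψ⟩
    rw [← Formula.realize_equivSentence]
    exact N.is_model.realize_of_mem _ (hs ψ hψ)
  by_contra hcon
  -- If the conjunction has no realization in `M`, this is a sentence of the complete theory, and it
  -- forces the negation of the conjunction into `q`.
  have hM' : M ⊨ χ.exClosure.not := by
    rw [Sentence.realize_not, Formula.realize_exClosure]
    rintro ⟨y, hy⟩
    let x : α → M := fun a => if h : a ∈ BoundedFormula.freeVarFinset χ then y ⟨a, h⟩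
      else Classical.arbitrary M
    have hx : χ.Realize x :=
      (BoundedFormula.realize_restrictFreeVar x (by intro a; simp [x])).1 hy
    rw [Formula.realize_iInf] at hx
    exact hcon ⟨x, fun ψ hψ => (realize_substParams ψ x).1 (hx ⟨ψ, hψ⟩)⟩
  have hmem : Formula.equivSentence χ.not ∈ q := by
    refine q.mem_of_models (Theory.models_formula_iff_onTheory_models_equivSentence.1 ?_)
    rw [Theory.models_formula_iff]
    intro N y
    rw [Formula.realize_not]
    intro hy
    have hN : N ⊨ χ.exClosure.not := N.is_model.realize_of_mem _ hM'
    rw [Sentence.realize_not, Formula.realize_exClosure] at hN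
    exact hN ⟨fun a => y a, (BoundedFormula.realize_restrictFreeVar y (by intro a; simp)).2 hy⟩
  exact ((q.not_mem_iff _).1 (show (Formula.equivSentence χ).not ∈ q from hmem)) hχ

/-- The setoid of having the same type over `A`. -/
def sameType (L : FirstOrder.Language.{u, v}) {M : Type w} [L.Structure M] [Nonempty M]
    (A : Set M) (ι : Type*) : Setoid (ι → M) := Setoid.ker fun a => tp L a A

/-- There is a bounded number of types in small tuples of variables over a small set. -/
theorem IsMonster.mk_sameType_lt (hM : IsMonster T κ M) {A : Set M} (hA : #A < κ)
    {ι : Type w} (hι : #ι < κ) : #(Quotient (sameType L A ι)) < κ := by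
  let F : Quotient (sameType L A ι) → Set (L.Formula (A ⊕ ι)) := Quotient.lift
    (fun a => {ψ | ψ.Realize (Sum.elim (fun b : A => (b : M)) a)})
    (fun a b h => Set.ext fun ψ => tp_eq_iff.1 h ψ)
  have hF : Function.Injective F := by
    rintro ⟨a⟩ ⟨b⟩ h
    exact Quotient.sound (tp_eq_iff.2 fun ψ => Set.ext_iff.1 h ψ)
  have h1 := Cardinal.mk_le_of_injective (hF.comp Equiv.ulift.{max u v}.injective)
  -- Formulas and tuples live in different universes, so the power set bound is taken after lifting
  -- `κ`.
  have hκ : (Cardinal.lift.{max u v} κ).IsStrongLimit := by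
    refine ⟨by simpa using hM.isStrongLimit.ne_zero, fun μ hμ => ?_⟩
    obtain ⟨μ', hμ', rfl⟩ := Cardinal.lt_lift_iff.1 hμ
    rw [← Cardinal.lift_two_power, Cardinal.lift_lt]
    exact hM.isStrongLimit.isStrongPrelimit hμ'
  have h2 : #(L.Formula (A ⊕ ι)) < Cardinal.lift.{max u v} κ := by
    have h3 : #(L.Formula (A ⊕ ι)) ≤ #(Σ n, L.BoundedFormula (A ⊕ ι) n) :=
      Cardinal.mk_le_of_injective (f := fun φ => ⟨0, φ⟩) fun _ _ h => by simpa using h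
    refine h3.trans_lt (BoundedFormula.card_le.trans_lt ?_)
    refine max_lt ?_ (Cardinal.add_lt_of_lt hκ.aleph0_le ?_ hM.language_small)
    · simpa using hM.aleph0_lt
    · exact Cardinal.lift_lt.2 (hM.mk_sum_lt hA hι)
  have h4 := hκ.isStrongPrelimit h2
  rw [← Cardinal.mk_set] at h4
  have h5 : Cardinal.lift.{max u v} #(Quotient (sameType L A ι)) < Cardinal.lift.{max u v} κ := by
    refine lt_of_le_of_lt ?_ h4
    simpa using h1
  exact Cardinal.lift_lt.1 h5

end Monster

/-! ### Indiscernible sequences and their finite types. -/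

section Families

variable {L : FirstOrder.Language.{u, v}} {M : Type w} [L.Structure M] [Nonempty M]

/-- The concatenation of the `α`-tuples `s (e j)`. -/
def tuple {I J α M : Type*} (s : I → α → M) (e : J → I) : J × α → M := fun p => s (e p.1) p.2

/-- A formula mentions finitely many variables, so it sees only an initial segment of the sequence.
-/
theorem tp_tuple_eq_of_forall {A : Set M} {α : Type*} {s s' : ℕ → α → M}
    (h : ∀ n, tp L (tuple s (Fin.val : Fin n → ℕ)) A = tp L (tuple s' (Fin.val : Fin n → ℕ)) A) :
    tp L (tuple s id) A = tp L (tuple s' id) A := by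
  classical
  rw [tp_eq_iff]
  intro ψ
  let F := (BoundedFormula.freeVarFinset ψ).toRight
  let N := F.sup Prod.fst + 1
  have hF : ∀ p : ℕ × α, Sum.inr p ∈ BoundedFormula.freeVarFinset ψ → p.1 < N := fun p hp =>
    Nat.lt_succ_of_le (Finset.le_sup (f := Prod.fst) (Finset.mem_toRight.2 hp))
  let f : BoundedFormula.freeVarFinset ψ → A ⊕ Fin N × α := fun x => match x with
    | ⟨Sum.inl c, _⟩ => Sum.inl c
    | ⟨Sum.inr p, hp⟩ => Sum.inr (⟨p.1, hF p hp⟩, p.2)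
  have key : ∀ t : ℕ → α → M,
      Formula.Realize (BoundedFormula.restrictFreeVar ψ f)
        (Sum.elim (fun c : A => (c : M)) (tuple t (Fin.val : Fin N → ℕ))) ↔
      ψ.Realize (Sum.elim (fun c : A => (c : M)) (tuple t id)) := by
    intro t
    refine BoundedFormula.realize_restrictFreeVar _ ?_
    rintro ⟨c | p, hp⟩
    · rfl
    · rfl
  rw [← key, ← key]
  exact tp_eq_iff.1 (h N) _

theorem Indiscernible.comp {A : Set M} {α β : Type*} {s : ℕ → α → M} (hs : Indiscernible L A s)
    (g : β → α) : Indiscernible L A (fun i => s i ∘ g) := fun n i j hi hj =>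
  tp_comp (hs n i j hi hj) (Prod.map id g)

theorem Indiscernible.automorphism {A : Set M} {α : Type*} {s : ℕ → α → M}
    (hs : Indiscernible L A s) (σ : M ≃[L] M) (hσ : ∀ c ∈ A, σ c = c) :
    Indiscernible L A (fun i => σ ∘ s i) := fun n i j hi hj =>
  (tp_automorphism σ hσ (tuple s i)).trans
    ((hs n i j hi hj).trans (tp_automorphism σ hσ (tuple s j)).symm)

theorem Indiscernible.tp_eq {A : Set M} {α : Type*} {s : ℕ → α → M}
    (hs : Indiscernible L A s) (i j : ℕ) : tp L (s i) A = tp L (s j) A :=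
  tp_comp (hs 1 (fun _ => i) (fun _ => j) (Subsingleton.strictMono _) (Subsingleton.strictMono _))
    (fun x => ((0 : Fin 1), x))

theorem Indiscernible.of_tp_eq {A : Set M} {α : Type*} {s : ℕ → α → M} (r : ∀ n, Fin n × α → M)
    (h : ∀ (n : ℕ) (e : Fin n → ℕ), StrictMono e → tp L (tuple s e) A = tp L (r n) A) :
    Indiscernible L A s := fun n i j hi hj => (h n i hi).trans (h n j hj).symm

end Families

/-! ### Stretching, reversing and extracting indiscernible sequences. -/

section Monster

variable {L : FirstOrder.Language.{u, v}} {T : L.Theory} {κ : Cardinal.{w}} {M : Type w}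
  [L.Structure M] [Nonempty M] {A : Set M} {α : Type w}

/-- An Ehrenfeucht–Mostowski type which is finitely realized is realized along any small linear
order. -/
theorem IsMonster.exists_family (hM : IsMonster T κ M) (hA : #A < κ) (hα : #α < κ) {I : Type w}
    [LinearOrder I] (hI : #I < κ) (r : ∀ n, Fin n × α → M)
    (hr : ∀ N, ∃ u : Fin N → α → M, ∀ (m : ℕ) (e : Fin m → Fin N), StrictMono e →
      tp L (tuple u e) A = tp L (r m) A) :
    ∃ s : I → α → M, ∀ (m : ℕ) (e : Fin m → I), StrictMono e →
      tp L (tuple s e) A = tp L (r m) A := by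
  classical
  let Γ : Set (L.Formula (A ⊕ I × α)) := {ψ | ∃ (m : ℕ) (e : Fin m → I), StrictMono e ∧
    ∃ φ : L.Formula (A ⊕ Fin m × α), φ.Realize (Sum.elim (fun c : A => (c : M)) (r m)) ∧
      ψ = φ.relabel (Sum.map id (Prod.map e id))}
  obtain ⟨x, hx⟩ := hM.exists_realization hA (hM.mk_prod_lt hI hα) (fun c : A => (c : M)) Γ (by
    intro S hS
    have hS' : ∀ ψ : S, ∃ (m : ℕ) (e : Fin m → I), StrictMono e ∧
      ∃ φ : L.Formula (A ⊕ Fin m × α), φ.Realize (Sum.elim (fun c : A => (c : M)) (r m)) ∧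
      ψ.1 = φ.relabel (Sum.map id (Prod.map e id)) := fun ψ => hS ψ.2
    choose m e he φ hφ hψ using hS'
    let J : Finset I := Finset.univ.biUnion fun ψ : S => Finset.univ.image (e ψ)
    have hJ : ∀ ψ k, e ψ k ∈ J := fun ψ k =>
      Finset.mem_biUnion.2 ⟨ψ, Finset.mem_univ _, Finset.mem_image_of_mem _ (Finset.mem_univ _)⟩
    obtain ⟨u, hu⟩ := hr J.card
    let o := J.orderIsoOfFin rfl
    -- Only the indices in `J` occur in the finitely many formulas; `u` is laid out along them in
    -- increasing order and the other values are irrelevant.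
    refine ⟨fun p => if h : p.1 ∈ J then u (o.symm ⟨p.1, h⟩) p.2 else Classical.arbitrary M,
      fun ψ hψS => ?_⟩
    have h1 := hψ ⟨ψ, hψS⟩
    simp only at h1
    rw [h1, Formula.realize_relabel, Sum.elim_comp_map, Function.comp_id]
    have h2 := hu _ (fun k => o.symm ⟨e ⟨ψ, hψS⟩ k, hJ _ k⟩) (fun a b hab =>
      o.symm.strictMono (Subtype.mk_lt_mk.2 (he _ hab)))
    refine Eq.mp ?_ ((tp_eq_iff.1 h2 _).2 (hφ ⟨ψ, hψS⟩))
    congr 2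
    funext p
    simp [tuple, hJ])
  refine ⟨fun i a => x (i, a), fun m e he => Eq.symm (tp_eq_of_imp fun φ hφ => ?_)⟩
  have := hx _ ⟨m, e, he, φ, hφ, rfl⟩
  rw [Formula.realize_relabel, Sum.elim_comp_map, Function.comp_id] at this
  exact this

theorem IsMonster.exists_sequence (hM : IsMonster T κ M) (hA : #A < κ) (hα : #α < κ)
    (r : ∀ n, Fin n × α → M)
    (hr : ∀ N, ∃ u : Fin N → α → M, ∀ (m : ℕ) (e : Fin m → Fin N), StrictMono e →
      tp L (tuple u e) A = tp L (r m) A) :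
    ∃ s : ℕ → α → M, ∀ (m : ℕ) (e : Fin m → ℕ), StrictMono e →
      tp L (tuple s e) A = tp L (r m) A := by
  obtain ⟨s, hs⟩ := hM.exists_family hA hα (I := ULift.{w} ℕ) (by simpa using hM.aleph0_lt) r hr
  exact ⟨fun n => s ⟨n⟩, fun m e he => hs m (fun k => ⟨e k⟩) fun a b hab => he hab⟩

/-- Indiscernible sequences can be stretched along any small linear order. -/
theorem IsMonster.exists_stretch (hM : IsMonster T κ M) (hA : #A < κ) (hα : #α < κ) {I : Type w}
    [LinearOrder I] (hI : #I < κ) {s : ℕ → α → M} (hs : Indiscernible L A s) :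
    ∃ s' : I → α → M, ∀ (m : ℕ) (e : Fin m → I) (i : Fin m → ℕ), StrictMono e → StrictMono i →
      tp L (tuple s' e) A = tp L (tuple s i) A := by
  obtain ⟨s', hs'⟩ := hM.exists_family hA hα hI (fun n => tuple s (Fin.val : Fin n → ℕ))
    (fun N => ⟨fun i => s i, fun m e he =>
      hs m (fun k => e k) Fin.val he Fin.val_strictMono⟩)
  exact ⟨s', fun m e i he hi => (hs' m e he).trans (hs m _ _ Fin.val_strictMono hi)⟩

/-- The finite types of the reversed sequence are realized by reversed finite pieces of `s`, hence
by an infinite sequence, which an automorphism then moves to start at `b, a`. -/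
theorem IsMonster.startIndiscernible_symm (hM : IsMonster T κ M) (hA : #A < κ) (hα : #α < κ)
    {a b : α → M} (h : StartIndiscernible L A a b) : StartIndiscernible L A b a := by
  obtain ⟨s, hs, rfl, rfl⟩ := h
  obtain ⟨s', hs'⟩ := hM.exists_sequence hA hα
    (fun n => tuple s (fun i : Fin n => ((Fin.rev i : Fin n) : ℕ))) (fun N =>
      ⟨fun i => s (Fin.rev i : Fin N), fun m e he => by
        have := hs m (fun k => ((Fin.rev (e (Fin.rev k)) : Fin N) : ℕ)) Fin.val
          (fun a b hab => by
            have := he (Fin.rev_lt_rev.2 hab)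
            exact Fin.rev_lt_rev.2 this) Fin.val_strictMono
        convert tp_comp this (Prod.map Fin.rev id) using 2
        · funext p
          simp [tuple]
        · rfl⟩)
  have h2 := hs' 2 Fin.val Fin.val_strictMono
  obtain ⟨σ, hσ, hσ'⟩ := hM.exists_automorphism hA (hM.mk_fin_prod_lt hα 2) h2
  refine ⟨fun i => σ ∘ s' i, (Indiscernible.of_tp_eq _ hs').automorphism σ hσ, ?_, ?_⟩
  · funext x
    exact congrFun hσ' (0, x)
  · funext x
    exact congrFun hσ' (1, x)

/-- Morley's theorem on extracting indiscernible sequences whose finite types are realized. -/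
theorem IsMonster.exists_extraction (hM : IsMonster T κ M) (hA : #A < κ) (hα : #α < κ) :
    ∃ μ < κ, ∀ {X : Type w} [LinearOrder X], μ ≤ #X → ∀ a : X → α → M,
      ∃ d : ℕ → α → M, Indiscernible L A d ∧ ∀ n, ∃ e : Fin n → X, StrictMono e ∧
        ∀ i : Fin n → ℕ, StrictMono i → tp L (tuple d i) A = tp L (tuple a e) A := by
  classical
  let C := Quotient (sameType L A (ℕ × α))
  have hC : #C < κ := hM.mk_sameType_lt hA (hM.mk_nat_prod_lt hα)
  let ν := max ℵ₀ #C
  have hν : ν < κ := max_lt hM.aleph0_lt hC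
  -- Since `κ = ℶ_κ` is a strong limit, `ν⁺ < κ` and this length is still small.
  refine ⟨ℶ_ (Order.succ ν).ord, ?_, ?_⟩
  · conv_rhs => rw [← hM.large]
    exact Cardinal.beth_lt_beth.2 (Cardinal.ord_lt_ord.2 (hM.isStrongLimit.isSuccLimit.succ_lt hν))
  intro X _ hX a
  -- Increasing enumerations are padded to length `ω`, so that finite sets of every size are
  -- coloured by the same set of types.
  let pad : Finset X → ℕ × α → M := fun s p =>
    if h : p.1 < s.card then a (s.orderEmbOfFin rfl ⟨p.1, h⟩) p.2 else Classical.arbitrary M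
  have hpad : ∀ (s : Finset X) (n : ℕ) (h : s.card = n) (k : Fin n) (x : α),
      pad s (k, x) = a (s.orderEmbOfFin h k) x := by
    rintro s _ rfl k x
    exact dif_pos k.2
  obtain ⟨t, ht⟩ := exists_coherent_colours (fun s => (Quotient.mk _ (pad s) : C)) ν
    (le_max_left _ _) (le_max_right _ _) hX
  let r : ∀ n, Fin n × α → M := fun n => (t n).out ∘ Prod.map Fin.val id
  have key : ∀ N, ∃ e : Fin N → X, StrictMono e ∧ ∀ (m : ℕ) (i : Fin m → Fin N), StrictMono i →
      tp L (tuple a (e ∘ i)) A = tp L (r m) A := by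
    intro N
    obtain ⟨s, hsN, hs⟩ := ht N
    refine ⟨s.orderEmbOfFin hsN, (s.orderEmbOfFin hsN).strictMono, fun m i hi => ?_⟩
    have hmono : StrictMono (s.orderEmbOfFin hsN ∘ i) := (s.orderEmbOfFin hsN).strictMono.comp hi
    let r' : Finset X := Finset.univ.image (s.orderEmbOfFin hsN ∘ i)
    have hcard : r'.card = m := by
      rw [Finset.card_image_of_injective _ hmono.injective, Finset.card_univ, Fintype.card_fin]
    have hr' : r' ⊆ s := by
      intro x hx
      obtain ⟨k, _, rfl⟩ := Finset.mem_image.1 hx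
      exact s.orderEmbOfFin_mem hsN _
    have h1 : (Quotient.mk (sameType L A (ℕ × α)) (pad r')) = Quotient.mk _ (t m).out := by
      rw [Quotient.out_eq]
      exact (hs r' hr').trans (by rw [hcard])
    have h2 : tp L (pad r') A = tp L (t m).out A := Quotient.exact h1
    have h3 := tp_comp h2 (Prod.map (Fin.val : Fin m → ℕ) (id : α → α))
    refine Eq.trans ?_ h3
    congr 1
    have huniq := Finset.orderEmbOfFin_unique hcard
      (f := s.orderEmbOfFin hsN ∘ i) (fun k => Finset.mem_image_of_mem _ (Finset.mem_univ _)) hmono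
    funext p
    refine Eq.trans ?_ (hpad r' m hcard p.1 p.2).symm
    rw [← huniq]
    rfl
  obtain ⟨d, hd⟩ := hM.exists_sequence hA hα r (fun N => by
    obtain ⟨e, _, he⟩ := key N
    exact ⟨fun i => a (e i), he⟩)
  refine ⟨d, Indiscernible.of_tp_eq r hd, fun n => ?_⟩
  obtain ⟨e, he, h⟩ := key n
  exact ⟨e, he, fun i hi => (hd n i hi).trans (h n id strictMono_id).symm⟩

end Monster

/-! ### Invariance of dividing, forking and Morley sequences. -/

section Nonforking

variable {L : FirstOrder.Language.{u, v}} {M : Type w} [L.Structure M] [Nonempty M] {A : Set M}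
  {α : Type*}

theorem typeForks_tp_iff {B : Set M} {c : α → M} : TypeForks A (tp L c B) ↔
    ∃ (n : ℕ) (φ : L.Formula (α ⊕ Fin n)) (b : Fin n → M), (∀ i, b i ∈ B) ∧
      φ.Realize (Sum.elim c b) ∧ Forks A φ b := by
  constructor
  · rintro ⟨n, φ, b, h, hf⟩
    exact ⟨n, φ, fun i => b i, fun i => (b i).2, (contains_tp c φ b).1 h, hf⟩
  · rintro ⟨n, φ, b, hb, h, hf⟩
    exact ⟨n, φ, fun i => ⟨b i, hb i⟩, (contains_tp c φ _).2 h, hf⟩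

theorem Divides.forks {n : ℕ} {φ : L.Formula (α ⊕ Fin n)} {b : Fin n → M} (h : Divides A φ b) :
    Forks A φ b :=
  ⟨1, fun _ => n, fun _ => φ, fun _ => b, fun _ => h, fun _ hx => ⟨0, hx⟩⟩

theorem Divides.automorphism {n : ℕ} {φ : L.Formula (α ⊕ Fin n)} {b : Fin n → M}
    (h : Divides A φ b) (σ : M ≃[L] M) (hσ : ∀ c ∈ A, σ c = c) : Divides A φ (σ ∘ b) := by
  obtain ⟨k, c, hc, hk⟩ := h
  exact ⟨k, c, fun i => (hc i).trans (tp_automorphism σ hσ b).symm, hk⟩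

theorem Forks.automorphism {n : ℕ} {φ : L.Formula (α ⊕ Fin n)} {b : Fin n → M}
    (h : Forks A φ b) (σ : M ≃[L] M) (hσ : ∀ c ∈ A, σ c = c) : Forks A φ (σ ∘ b) := by
  obtain ⟨m, r, ψ, c, hd, himp⟩ := h
  refine ⟨m, r, ψ, fun j => σ ∘ c j, fun j => (hd j).automorphism σ hσ, fun x hx => ?_⟩
  have hσx : σ ∘ (σ.symm ∘ x) = x := funext fun i => σ.apply_symm_apply _
  rw [← hσx, ← Sum.comp_elim, StrongHomClass.realize_formula σ] at hx
  obtain ⟨j, hj⟩ := himp _ hx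
  refine ⟨j, ?_⟩
  rw [← hσx, ← Sum.comp_elim, StrongHomClass.realize_formula σ]
  exact hj

/-- Nonforking passes to smaller bases and along automorphisms fixing the base. -/
theorem not_typeForks_automorphism {B B' : Set M} {c : α → M} (h : ¬ TypeForks A (tp L c B))
    (σ : M ≃[L] M) (hσ : ∀ c ∈ A, σ c = c) (hB : ∀ b ∈ B', σ.symm b ∈ B) :
    ¬ TypeForks A (tp L (σ ∘ c) B') := by
  intro h'
  obtain ⟨n, φ, b, hb, hφ, hf⟩ := typeForks_tp_iff.1 h'
  refine h (typeForks_tp_iff.2 ⟨n, φ, σ.symm ∘ b, fun i => hB _ (hb i), ?_,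
    hf.automorphism σ.symm (symm_fixes σ hσ)⟩)
  have hb' : σ ∘ (σ.symm ∘ b) = b := funext fun i => σ.apply_symm_apply _
  rwa [← hb', ← Sum.comp_elim, StrongHomClass.realize_formula σ] at hφ

theorem IsMorley.automorphism {c : ℕ → α → M} (h : IsMorley L A c) (σ : M ≃[L] M)
    (hσ : ∀ c ∈ A, σ c = c) : IsMorley L A (fun i => σ ∘ c i) := by
  refine ⟨h.1.automorphism σ hσ, fun i => not_typeForks_automorphism (h.2 i) σ hσ ?_⟩
  rintro b (hb | ⟨j, hj, x, rfl⟩)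
  · exact Or.inl (by rwa [symm_fixes σ hσ b hb])
  · exact Or.inr ⟨j, hj, x, (σ.symm_apply_apply _).symm⟩

end Nonforking

/-! ### Nonforking makes an indiscernible sequence indiscernible over a conjugate. -/

section Monster

variable {L : FirstOrder.Language.{u, v}} {T : L.Theory} {κ : Cardinal.{w}} {M : Type w}
  [L.Structure M] [Nonempty M] {A : Set M} {β γ : Type w}

/-- If `tp(c / A s₀)` does not fork over `A`, then its conjugates along a family with the same
Ehrenfeucht–Mostowski type over `A` as the indiscernible sequence `s` have a common realization. -/
theorem IsMonster.exists_common_realization (hM : IsMonster T κ M) (hA : #A < κ) (hβ : #β < κ)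
    (hγ : #γ < κ) {s : ℕ → β → M} (hs : Indiscernible L A s) {c : γ → M} {B : Set M}
    (hAB : A ⊆ B) (hB : ∀ x, s 0 x ∈ B) (hc : ¬ TypeForks A (tp L c B)) {I : Type w}
    [LinearOrder I] (hI : #I < κ) {s' : I → β → M}
    (hs' : ∀ (m : ℕ) (e : Fin m → I) (i : Fin m → ℕ), StrictMono e → StrictMono i →
      tp L (tuple s' e) A = tp L (tuple s i) A) :
    ∃ c' : γ → M, ∀ i, tp L (Sum.elim (s' i) c') A = tp L (Sum.elim (s 0) c) A := by
  classical
  let g : I → A ⊕ (β ⊕ γ) → (A ⊕ I × β) ⊕ γ := fun i =>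
    Sum.elim (Sum.inl ∘ Sum.inl) (Sum.map (fun b => Sum.inr (i, b)) id)
  let v : A ⊕ I × β → M := Sum.elim (fun a : A => (a : M)) (fun p => s' p.1 p.2)
  have hg : ∀ (i : I) (x : γ → M), Sum.elim v x ∘ g i =
      Sum.elim (fun a : A => (a : M)) (Sum.elim (s' i) x) := by
    intro i x
    funext z
    rcases z with z | z | z <;> rfl
  let Γ : Set (L.Formula ((A ⊕ I × β) ⊕ γ)) := {ψ | ∃ (i : I) (φ : L.Formula (A ⊕ (β ⊕ γ))),
    φ.Realize (Sum.elim (fun a : A => (a : M)) (Sum.elim (s 0) c)) ∧ ψ = φ.relabel (g i)}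
  obtain ⟨x, hx⟩ := hM.exists_realization (hM.mk_sum_lt hA (hM.mk_prod_lt hI hβ)) hγ v Γ (by
    intro S hS
    have hS' : ∀ ψ : S, ∃ (i : I) (φ : L.Formula (A ⊕ (β ⊕ γ))),
      φ.Realize (Sum.elim (fun a : A => (a : M)) (Sum.elim (s 0) c)) ∧ ψ.1 = φ.relabel (g i) :=
      fun ψ => hS ψ.2
    choose i φ hφ hψ using hS'
    let Φ : L.Formula (A ⊕ (β ⊕ γ)) := Formula.iInf φ
    let J : Finset I := Finset.univ.image i
    suffices h : ∃ x : γ → M, ∀ j ∈ J,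
        Φ.Realize (Sum.elim (fun a : A => (a : M)) (Sum.elim (s' j) x)) by
      obtain ⟨x, hx⟩ := h
      refine ⟨x, fun ψ hψS => ?_⟩
      have h1 := hx (i ⟨ψ, hψS⟩) (Finset.mem_image_of_mem _ (Finset.mem_univ _))
      rw [Formula.realize_iInf] at h1
      have h2 := hψ ⟨ψ, hψS⟩
      simp only at h2
      rw [h2, Formula.realize_relabel, hg]
      exact h1 _
    by_contra hcon
    -- `Φ` is inconsistent along the terms of `s'` indexed by `J`. Any `J.card` terms of `s` are
    -- conjugate to these over `A`, so `s` witnesses that `Φ` over `s 0` divides. `θ` is `Φ` with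
    -- its finitely many parameters isolated.
    obtain ⟨n, θ, p, hθ⟩ := exists_finite_params (M := M) (Φ.relabel (Equiv.sumAssoc A β γ).symm)
    have hθ' : ∀ (y : β → M) (x : γ → M),
        θ.Realize (Sum.elim x (Sum.elim (fun a : A => (a : M)) y ∘ p)) ↔
          Φ.Realize (Sum.elim (fun a : A => (a : M)) (Sum.elim y x)) := by
      intro y x
      rw [hθ, Formula.realize_relabel]
      refine iff_of_eq (congrArg _ ?_)
      funext z
      rcases z with z | z | z <;> rfl
    apply hc
    refine typeForks_tp_iff.2 ⟨n, θ, Sum.elim (fun a : A => (a : M)) (s 0) ∘ p, ?_, ?_, ?_⟩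
    · intro k
      simp only [Function.comp_apply]
      rcases p k with a | b
      · exact hAB a.2
      · exact hB b
    · rw [hθ', Formula.realize_iInf]
      exact hφ
    · refine Divides.forks ⟨J.card, fun j => Sum.elim (fun a : A => (a : M)) (s j) ∘ p,
        fun j => tp_comp_params (hs.tp_eq j 0) p, fun r hr => ?_⟩
      rintro ⟨x, hx⟩
      obtain ⟨σ, hσ, hσ'⟩ := hM.exists_automorphism hA (hM.mk_fin_prod_lt hβ J.card)
        (hs' J.card (J.orderEmbOfFin rfl) (r.orderEmbOfFin hr) (J.orderEmbOfFin rfl).strictMono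
          (r.orderEmbOfFin hr).strictMono).symm
      refine hcon ⟨σ ∘ x, fun j hj => ?_⟩
      obtain ⟨k, rfl⟩ : ∃ k, J.orderEmbOfFin rfl k = j := by
        have : j ∈ Set.range (J.orderEmbOfFin rfl) := by rwa [Finset.range_orderEmbOfFin]
        exact this
      have h1 := (hθ' _ _).1 (hx (r.orderEmbOfFin hr k) (Finset.orderEmbOfFin_mem _ _ _))
      have h2 : s' (J.orderEmbOfFin rfl k) = σ ∘ s (r.orderEmbOfFin hr k) :=
        funext fun b => (congrFun hσ' (k, b)).symm
      rw [h2, ← Sum.comp_elim]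
      exact (realize_automorphism σ hσ Φ _).2 h1)
  refine ⟨x, fun i => Eq.symm (tp_eq_of_imp fun φ hφ => ?_)⟩
  have := hx _ ⟨i, φ, hφ, rfl⟩
  rwa [Formula.realize_relabel, hg] at this

/-- If `tp(c / A s₀)` does not fork over `A`, then `s` is indiscernible over some conjugate of `c`
over `A s₀`. -/
theorem IsMonster.exists_indiscernible_over (hM : IsMonster T κ M) (hA : #A < κ) (hβ : #β < κ)
    (hγ : #γ < κ) {s : ℕ → β → M} (hs : Indiscernible L A s) {c : γ → M} {B : Set M}
    (hAB : A ⊆ B) (hB : ∀ x, s 0 x ∈ B) (hc : ¬ TypeForks A (tp L c B)) :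
    ∃ c' : γ → M, Indiscernible L A (fun i => Sum.elim (s i) c') ∧
      tp L (Sum.elim (s 0) c') A = tp L (Sum.elim (s 0) c) A := by
  obtain ⟨μ, hμ, hext⟩ := hM.exists_extraction (L := L) hA (hM.mk_sum_lt hβ hγ)
  have hX : #μ.ord.ToType < κ := by simpa using hμ
  obtain ⟨s', hs'⟩ := hM.exists_stretch hA hβ hX hs
  obtain ⟨c₁, hc₁⟩ := hM.exists_common_realization hA hβ hγ hs hAB hB hc hX hs'
  obtain ⟨d, hd, hde⟩ := hext (X := μ.ord.ToType) (by simp) (fun i => Sum.elim (s' i) c₁)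
  -- The second component is the constant `c₁` in the family extracted from, and equality of
  -- coordinates is part of the type.
  have hconst : ∀ i z, d i (Sum.inr z) = d 0 (Sum.inr z) := by
    intro i z
    obtain ⟨e, -, h⟩ := hde (i + 1)
    exact eq_of_tp_eq (h Fin.val Fin.val_strictMono).symm
      (i := (Fin.last i, Sum.inr z)) (j := (0, Sum.inr z)) rfl
  have hseq : tp L (tuple (fun i => d i ∘ Sum.inl) id) A = tp L (tuple s id) A := by
    refine tp_tuple_eq_of_forall fun n => ?_
    obtain ⟨e, he, h⟩ := hde n
    exact (tp_comp (h Fin.val Fin.val_strictMono) (Prod.map id Sum.inl)).trans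
      (hs' n e _ he Fin.val_strictMono)
  obtain ⟨σ, hσ, hσ'⟩ := hM.exists_automorphism hA (hM.mk_nat_prod_lt hβ) hseq
  have hσd : ∀ i, σ ∘ d i = Sum.elim (s i) (σ ∘ d 0 ∘ Sum.inr) := by
    intro i
    funext z
    rcases z with z | z
    · exact congrFun hσ' (i, z)
    · exact congrArg σ (hconst i z)
  refine ⟨σ ∘ d 0 ∘ Sum.inr, ?_, ?_⟩
  · simpa only [hσd] using hd.automorphism σ hσ
  · rw [← hσd, tp_automorphism σ hσ]
    obtain ⟨e, -, h⟩ := hde 1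
    exact (tp_comp (h Fin.val Fin.val_strictMono) (fun z => ((0 : Fin 1), z))).trans (hc₁ (e 0))

end Monster

/-! ### Existence of Morley sequences, and a common Morley tail. -/

section Monster

variable {L : FirstOrder.Language.{u, v}} {T : L.Theory} {κ : Cardinal.{w}} {M : Type w}
  [L.Structure M] [Nonempty M] {A : Set M} {α : Type w}

/-- Otherwise both negations would lie in `q` and have a common realization in `M`. -/
theorem equivSentence_substParams_mem_or {α : Type*} (q : TypeOver L (Set.univ : Set M) α)
    {ψ ψ' : L.Formula ((Set.univ : Set M) ⊕ α)}
    (h : ∀ x : α → M, ψ.Realize (Sum.elim (fun b : (Set.univ : Set M) => (b : M)) x) ∨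
      ψ'.Realize (Sum.elim (fun b : (Set.univ : Set M) => (b : M)) x)) :
    Formula.equivSentence (substParams ψ) ∈ q ∨ Formula.equivSentence (substParams ψ') ∈ q := by
  classical
  by_contra hcon
  push Not at hcon
  obtain ⟨x, hx⟩ := exists_realization_of_mem q {ψ.not, ψ'.not} (by
    intro χ hχ
    simp only [Finset.mem_insert, Finset.mem_singleton] at hχ
    rcases hχ with rfl | rfl
    · exact (q.not_mem_iff _).2 hcon.1
    · exact (q.not_mem_iff _).2 hcon.2)
  have h1 := hx ψ.not (by simp)
  have h2 := hx ψ'.not (by simp)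
  rw [Formula.realize_not] at h1 h2
  exact (h x).elim h1 h2

/-- Over any small set containing `A`, an extensible type over `A` has a realization whose type
does not fork over `A`. -/
theorem IsMonster.exists_nonforking_realization (hM : IsMonster T κ M) (hα : #α < κ)
    {p : TypeOver L A α} (hp : Extensible p) {B : Set M} (hAB : A ⊆ B) (hB : #B < κ) :
    ∃ c : α → M, tp L c A = p ∧ ¬ TypeForks A (tp L c B) := by
  classical
  obtain ⟨q, hpq, hq⟩ := hp
  let l : B ⊕ α → (Set.univ : Set M) ⊕ α := Sum.map (fun b => ⟨b, trivial⟩) id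
  have hl : ∀ x : α → M, Sum.elim (fun b : (Set.univ : Set M) => (b : M)) x ∘ l =
      Sum.elim (fun b : B => (b : M)) x := by
    intro x
    funext z
    rcases z with z | z <;> rfl
  obtain ⟨c, hc⟩ := hM.exists_realization hB hα (fun b : B => (b : M))
    {ψ | Formula.equivSentence (substParams (ψ.relabel l)) ∈ q} (by
      intro s hs
      obtain ⟨x, hx⟩ := exists_realization_of_mem q (s.image (Formula.relabel l)) (by
        intro ψ hψ
        obtain ⟨ψ', hψ', rfl⟩ := Finset.mem_image.1 hψ
        exact hs hψ')
      refine ⟨x, fun ψ hψ => ?_⟩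
      have := hx _ (Finset.mem_image_of_mem _ hψ)
      rwa [Formula.realize_relabel, hl] at this)
  have key : ∀ {n : ℕ} (φ : L.Formula (α ⊕ Fin n)) (b : Fin n → B),
      φ.Realize (Sum.elim c (fun i => (b i : M))) →
        Contains q φ (fun i => ⟨(b i : M), trivial⟩) := by
    intro n φ b h
    let ψ : L.Formula (B ⊕ α) := φ.relabel (Sum.elim Sum.inr (Sum.inl ∘ b))
    have hψ : ∀ x : α → M, ψ.Realize (Sum.elim (fun b : B => (b : M)) x) ↔
        φ.Realize (Sum.elim x (fun i => (b i : M))) := by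
      intro x
      rw [Formula.realize_relabel, Sum.comp_elim]
      rfl
    refine (equivSentence_substParams_mem_or q
      (ψ := φ.relabel (Sum.elim Sum.inr (Sum.inl ∘ fun i => ⟨(b i : M), trivial⟩)))
      (ψ' := ψ.not.relabel l) fun x => ?_).resolve_right fun hn => ?_
    · rw [Formula.realize_relabel, Formula.realize_relabel, hl, Formula.realize_not, hψ,
        Sum.comp_elim]
      exact em _
    · have h1 := hc _ hn
      rw [Formula.realize_not, hψ] at h1
      exact h1 h
  refine ⟨c, ?_, ?_⟩
  · apply SetLike.ext
    have hsub : ∀ φ ∈ p, φ ∈ tp L c A := by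
      intro φ hφ
      -- With `p` presented as the type of a tuple, membership in `p` becomes truth at `a`; a
      -- formula of `p` failing at `c` would put itself and its negation into `q`.
      obtain ⟨a, rfl⟩ := hM.saturated A ((Cardinal.mk_le_mk_of_subset hAB).trans_lt hB) α hα p
      obtain ⟨ψ, rfl⟩ := exists_eq_equivSentence_substParams φ
      obtain ⟨n, θ, g, hθ⟩ := exists_finite_params (M := M) ψ
      rw [mem_tp_iff, ← hθ] at hφ ⊢
      by_contra hn
      have h1 := hpq n θ g ((contains_tp a θ g).2 hφ)
      have h2 := key θ.not (fun i => ⟨g i, hAB (g i).2⟩) (Formula.realize_not.2 hn)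
      obtain ⟨x, hx⟩ := exists_realization_of_mem q
        {θ.relabel (Sum.elim Sum.inr (Sum.inl ∘ fun i => ⟨(g i : M), trivial⟩)),
          θ.not.relabel (Sum.elim Sum.inr (Sum.inl ∘ fun i => ⟨(g i : M), trivial⟩))} (by
        intro χ hχ
        simp only [Finset.mem_insert, Finset.mem_singleton] at hχ
        rcases hχ with rfl | rfl
        · exact h1
        · exact h2)
      have h3 := hx _ (Finset.mem_insert_self _ _)
      have h4 := hx _ (Finset.mem_insert_of_mem (Finset.mem_singleton_self _))
      rw [Formula.realize_relabel] at h3 h4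
      exact Formula.realize_not.1 h4 h3
    intro φ
    refine ⟨fun h => ?_, hsub φ⟩
    by_contra hn
    exact ((tp L c A).not_mem_iff φ).1 (hsub _ ((p.not_mem_iff φ).2 hn)) h
  · intro h
    obtain ⟨n, φ, b, hb, hφ, hf⟩ := typeForks_tp_iff.1 h
    exact hq ⟨n, φ, _, key φ (fun i => ⟨b i, hb i⟩) hφ, hf⟩

/-- There is a Morley sequence in every extensible type. -/
theorem IsMonster.exists_isMorley (hM : IsMonster T κ M) (hA : #A < κ) (hα : #α < κ)
    {p : TypeOver L A α} (hp : Extensible p) :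
    ∃ c : ℕ → α → M, IsMorley L A c ∧ tp L (c 0) A = p := by
  obtain ⟨μ, hμ, hext⟩ := hM.exists_extraction (L := L) hA hα
  -- A choice defined for every set `B`, so that the recursion can run before its bases are known to
  -- be small.
  have hG : ∀ B : Set M, ∃ c : α → M, A ⊆ B → #B < κ →
      tp L c A = p ∧ ¬ TypeForks A (tp L c B) := by
    intro B
    by_cases h : A ⊆ B ∧ #B < κ
    · obtain ⟨c, hc⟩ := hM.exists_nonforking_realization hα hp h.1 h.2
      exact ⟨c, fun _ _ => hc⟩
    · exact ⟨fun _ => Classical.arbitrary M, fun h1 h2 => absurd ⟨h1, h2⟩ h⟩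
  choose G hG using hG
  let X := μ.ord.ToType
  let a : X → α → M := (wellFounded_lt (α := X)).fix fun i ih =>
    G (A ∪ {z | ∃ (j : X) (h : j < i), z ∈ Set.range (ih j h)})
  have ha : ∀ i, a i = G (A ∪ {z | ∃ j < i, z ∈ Set.range (a j)}) := by
    intro i
    simp only [a]
    rw [WellFounded.fix_eq]
    simp only [exists_prop]
  have hsmall : ∀ i, #(A ∪ {z | ∃ j < i, z ∈ Set.range (a j)} : Set M) < κ := by
    intro i
    refine (Cardinal.mk_union_le _ _).trans_lt (Cardinal.add_lt_of_lt hM.aleph0_lt.le hA ?_)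
    have h1 : {z | ∃ j < i, z ∈ Set.range (a j)} ⊆ Set.range (fun p : X × α => a p.1 p.2) := by
      rintro _ ⟨j, _, x, rfl⟩
      exact ⟨(j, x), rfl⟩
    refine (Cardinal.mk_le_mk_of_subset h1).trans_lt (Cardinal.mk_range_le.trans_lt ?_)
    exact hM.mk_prod_lt (by simpa [X] using hμ) hα
  have hgood : ∀ i, tp L (a i) A = p ∧
      ¬ TypeForks A (tp L (a i) (A ∪ {z | ∃ j < i, z ∈ Set.range (a j)})) := by
    intro i
    have := hG _ Set.subset_union_left (hsmall i)
    rwa [← ha i] at this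
  obtain ⟨d, hd, hde⟩ := hext (X := X) (by simp [X]) a
  refine ⟨d, ⟨hd, fun i => ?_⟩, ?_⟩
  -- The first `i + 1` terms of `d` are conjugate to terms of `a` at increasing indices. The base
  -- for the last of them was everything earlier in `a`, which contains the images of the preceding
  -- terms.
  · obtain ⟨e, he, h⟩ := hde (i + 1)
    obtain ⟨σ, hσ, hσ'⟩ := hM.exists_automorphism hA (hM.mk_fin_prod_lt hα _)
      (h Fin.val Fin.val_strictMono).symm
    have hσe : ∀ k : Fin (i + 1), σ ∘ a (e k) = d k := fun k =>
      funext fun x => congrFun hσ' (k, x)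
    have := not_typeForks_automorphism (hgood (e (Fin.last i))).2 σ hσ
      (B' := A ∪ {c | ∃ j < i, c ∈ Set.range (d j)}) (by
        rintro b (hb | ⟨j, hj, x, rfl⟩)
        · exact Or.inl (by rwa [symm_fixes σ hσ b hb])
        · refine Or.inr ⟨e ⟨j, by omega⟩, he (Fin.mk_lt_mk.2 hj), x, ?_⟩
          rw [← hσe ⟨j, by omega⟩]
          exact (σ.symm_apply_apply _).symm)
    rwa [hσe] at this
  · obtain ⟨e, -, h⟩ := hde 1
    exact (tp_comp (h Fin.val Fin.val_strictMono) (fun z => ((0 : Fin 1), z))).trans (hgood (e 0)).1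

/-- If a Morley sequence and an indiscernible sequence `s` start with the same tuple, then the
first two terms of `s` start Morley sequences with the same tail. -/
theorem IsMonster.exists_common_morley (hM : IsMonster T κ M) (hA : #A < κ) (hα : #α < κ)
    {s : ℕ → α → M} (hs : Indiscernible L A s) {c : ℕ → α → M} (hc : IsMorley L A c)
    (h0 : c 0 = s 0) : ∃ b : α → M, ∀ i, StartMorley L A (s i) b := by
  let ext : ℕ → (ℕ → α → M) → ℕ → α → M := fun i u k => Nat.casesOn k (s i) u
  -- Invariant: `s` is indiscernible over the first `n` terms of the new tail `u`, and `s 0` with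
  -- these terms is conjugate to the first `n + 1` terms of `c`.
  obtain ⟨u, hu⟩ := exists_seq_of_step
    (fun n u => Indiscernible L A
        (fun i => Sum.elim (s i) (tuple u (Fin.val : Fin n → ℕ))) ∧
      tp L (Sum.elim (s 0) (tuple u (Fin.val : Fin n → ℕ))) A =
        tp L (Sum.elim (c 0) (tuple c (fun k : Fin n => (k : ℕ) + 1))) A)
    (by
      intro n u v huv h
      have : tuple u (Fin.val : Fin n → ℕ) = tuple v (Fin.val : Fin n → ℕ) :=
        funext fun p => congrFun (huv p.1 p.1.2) p.2
      rwa [← this])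
    (by
      intro u
      refine ⟨?_, ?_⟩
      · convert hs.comp (Sum.elim id (fun p : Fin 0 × α => p.1.elim0)) using 1
        funext i z
        rcases z with z | z
        · rfl
        · exact z.1.elim0
      · congr 1
        funext z
        rcases z with z | z
        · exact congrFun h0.symm z
        · exact z.1.elim0)
    (by
      rintro n u ⟨hind, htp⟩
      have hβ : #(α ⊕ Fin n × α) < κ := hM.mk_sum_lt hα (hM.mk_fin_prod_lt hα n)
      obtain ⟨σ, hσ, hσ'⟩ := hM.exists_automorphism hA hβ htp.symm
      have hσ0 : ∀ x, σ (c 0 x) = s 0 x := fun x => congrFun hσ' (Sum.inl x)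
      have hσu : ∀ (k : Fin n) x, σ (c (k + 1) x) = u k x := fun k x =>
        congrFun hσ' (Sum.inr (k, x))
      have hnf := not_typeForks_automorphism (hc.2 (n + 1)) σ hσ
        (B' := A ∪ Set.range (Sum.elim (s 0) (tuple u (Fin.val : Fin n → ℕ)))) (by
          rintro b (hb | ⟨x | ⟨k, x⟩, rfl⟩)
          · exact Or.inl (by rwa [symm_fixes σ hσ b hb])
          · refine Or.inr ⟨0, by omega, x, ?_⟩
            simp only [Sum.elim_inl]
            rw [← hσ0]
            exact (σ.symm_apply_apply _).symm
          · refine Or.inr ⟨k + 1, by omega, x, ?_⟩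
            simp only [Sum.elim_inr, tuple]
            rw [← hσu]
            exact (σ.symm_apply_apply _).symm)
      -- Applied to the sequence of tuples `s i` followed by the current `u`, with the conjugate of
      -- `c (n + 1)` as the nonforking tuple.
      obtain ⟨c', hc', hc'tp⟩ := hM.exists_indiscernible_over hA hβ hα hind
        (B := A ∪ Set.range (Sum.elim (s 0) (tuple u (Fin.val : Fin n → ℕ))))
        Set.subset_union_left (fun x => Or.inr ⟨x, rfl⟩) hnf
      let g : α ⊕ Fin (n + 1) × α → (α ⊕ Fin n × α) ⊕ α := Sum.elim (Sum.inl ∘ Sum.inl)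
        (fun p => if h : (p.1 : ℕ) < n then Sum.inl (Sum.inr (⟨p.1, h⟩, p.2)) else Sum.inr p.2)
      have hg : ∀ i, Sum.elim (s i) (tuple (Function.update u n c') (Fin.val : Fin (n + 1) → ℕ)) =
          Sum.elim (Sum.elim (s i) (tuple u (Fin.val : Fin n → ℕ))) c' ∘ g := by
        intro i
        funext z
        rcases z with z | ⟨k, z⟩
        · rfl
        · by_cases h : (k : ℕ) < n
          · simp [g, tuple, h, Function.update_of_ne h.ne]
          · have hk : (k : ℕ) = n := by omega
            simp [g, tuple, hk]
      refine ⟨c', ?_, ?_⟩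
      · simp only [hg]
        exact hc'.comp g
      · rw [hg, tp_comp hc'tp g, ← hσ', ← Sum.comp_elim, Function.comp_assoc, tp_automorphism σ hσ]
        congr 1
        funext z
        rcases z with z | ⟨k, z⟩
        · rfl
        · by_cases h : (k : ℕ) < n
          · simp [g, tuple, h]
          · have hk : (k : ℕ) = n := by omega
            simp [g, tuple, hk])
  refine ⟨u 0, fun i => ?_⟩
  have hseq : tp L (tuple c id) A = tp L (tuple (ext i u) id) A := by
    refine tp_tuple_eq_of_forall fun n => ?_
    let g : Fin n × α → α ⊕ Fin n × α := fun p =>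
      if h : (p.1 : ℕ) = 0 then Sum.inl p.2 else Sum.inr (⟨p.1 - 1, by omega⟩, p.2)
    have h1 := tp_comp (((hu n).1.tp_eq i 0).trans (hu n).2).symm g
    convert h1 using 2
    · funext ⟨k, x⟩
      by_cases h : (k : ℕ) = 0
      · simp [g, tuple, h]
      · simp [g, tuple, h, Nat.sub_add_cancel (Nat.pos_of_ne_zero h)]
    · funext ⟨k, x⟩
      by_cases h : (k : ℕ) = 0
      · simp [g, tuple, h, ext]
      · obtain ⟨m, hm⟩ := Nat.exists_eq_succ_of_ne_zero h
        simp [g, tuple, hm, ext]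
  obtain ⟨σ, hσ, hσ'⟩ := hM.exists_automorphism hA (hM.mk_nat_prod_lt hα) hseq
  exact ⟨fun k => σ ∘ c k, hc.automorphism σ hσ, funext fun x => congrFun hσ' (0, x),
    funext fun x => congrFun hσ' (1, x)⟩

end Monster

/-! ### Comparison of `≡'_A` with both forms of Lascar equivalence. -/

section Monster

variable {L : FirstOrder.Language.{u, v}} {T : L.Theory} {κ : Cardinal.{w}} {M : Type w}
  [L.Structure M] [Nonempty M] {A : Set M} {α : Type w}

theorem StartMorley.startIndiscernible {a b : α → M} (h : StartMorley L A a b) :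
    StartIndiscernible L A a b := by
  obtain ⟨s, hs, h0, h1⟩ := h
  exact ⟨s, hs.1, h0, h1⟩

theorem StartIndiscernible.tp_eq {a b : α → M} (h : StartIndiscernible L A a b) :
    tp L a A = tp L b A := by
  obtain ⟨s, hs, rfl, rfl⟩ := h
  exact hs.tp_eq 0 1

theorem lascarChain_iff_reflTransGen {a b : α → M} :
    LascarChain L A a b ↔ Relation.ReflTransGen (StartIndiscernible L A) a b := by
  constructor
  · rintro ⟨n, c, rfl, rfl, h⟩
    have : ∀ i ≤ n, Relation.ReflTransGen (StartIndiscernible L A) (c 0) (c i) := by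
      intro i
      induction i with
      | zero => exact fun _ => .refl
      | succ i ih => exact fun hi => (ih (by omega)).tail (h i hi)
    exact this n le_rfl
  · intro h
    induction h with
    | refl => exact ⟨0, fun _ => a, rfl, rfl, fun i hi => absurd hi (by omega)⟩
    | @tail b d _ hbd ih =>
      obtain ⟨n, c, h0, hn, h⟩ := ih
      refine ⟨n + 1, Function.update c (n + 1) d, ?_, ?_, fun i hi => ?_⟩
      · rw [Function.update_of_ne (by omega), h0]
      · rw [Function.update_self]
      · rw [Function.update_of_ne (by omega)]
        rcases Nat.lt_succ_iff_lt_or_eq.1 hi with h1 | rfl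
        · rw [Function.update_of_ne (by omega)]
          exact h i h1
        · rw [Function.update_self, hn]
          exact hbd

theorem IsMonster.lascarChain_of_morleyEquiv (hM : IsMonster T κ M) (hA : #A < κ) (hα : #α < κ)
    {a b : α → M} (h : MorleyEquiv L A a b) : LascarChain L A a b := by
  rw [lascarChain_iff_reflTransGen]
  have key : ∀ x y : α → M, StartMorley L A x y ∨ StartMorley L A y x →
      StartIndiscernible L A x y := fun x y hxy => hxy.elim StartMorley.startIndiscernible
    fun h => hM.startIndiscernible_symm hA hα h.startIndiscernible
  induction h with
  | single h => exact .single (key _ _ h)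
  | tail _ h ih => exact ih.tail (key _ _ h)

theorem StartMorley.morleyEquiv {a b c : α → M} (h : StartMorley L A a c)
    (h' : StartMorley L A b c) : MorleyEquiv L A a b := by
  refine Relation.TransGen.tail (b := c) (Relation.TransGen.single ?_) ?_
  · exact Or.inl h
  · exact Or.inr h'

theorem IsMonster.exists_isMorley_from (hM : IsMonster T κ M) (hA : #A < κ) (hα : #α < κ)
    {p : TypeOver L A α} (hp : Extensible p) {a : α → M} (ha : tp L a A = p) :
    ∃ c : ℕ → α → M, IsMorley L A c ∧ c 0 = a := by
  obtain ⟨c, hc, hcp⟩ := hM.exists_isMorley hA hα hp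
  obtain ⟨σ, hσ, hσ'⟩ := hM.exists_automorphism hA hα (hcp.trans ha.symm)
  exact ⟨fun i => σ ∘ c i, hc.automorphism σ hσ, hσ'⟩

theorem IsMonster.morleyEquiv_of_startIndiscernible (hM : IsMonster T κ M) (hA : #A < κ)
    (hα : #α < κ) {p : TypeOver L A α} (hp : Extensible p) {a b : α → M} (ha : tp L a A = p)
    (h : StartIndiscernible L A a b) : MorleyEquiv L A a b := by
  obtain ⟨s, hs, rfl, rfl⟩ := h
  obtain ⟨c, hc, hc0⟩ := hM.exists_isMorley_from hA hα hp ha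
  obtain ⟨d, hd⟩ := hM.exists_common_morley hA hα hs hc hc0
  exact (hd 0).morleyEquiv (hd 1)

/-- A transitive closure need not be reflexive: extensibility provides a Morley sequence from `a`,
and one steps along it and back. This covers Lascar chains of length zero. -/
theorem IsMonster.morleyEquiv_refl (hM : IsMonster T κ M) (hA : #A < κ) (hα : #α < κ)
    {p : TypeOver L A α} (hp : Extensible p) {a : α → M} (ha : tp L a A = p) :
    MorleyEquiv L A a a := by
  obtain ⟨c, hc, rfl⟩ := hM.exists_isMorley_from hA hα hp ha
  have h : StartMorley L A (c 0) (c 1) := ⟨c, hc, rfl, rfl⟩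
  exact h.morleyEquiv h

theorem MorleyEquiv.symm {a b : α → M} (h : MorleyEquiv L A a b) : MorleyEquiv L A b a := by
  induction h with
  | single h => exact .single h.symm
  | tail _ h ih => exact Relation.TransGen.head h.symm ih

theorem MorleyEquiv.automorphism {a b : α → M} (h : MorleyEquiv L A a b) (σ : M ≃[L] M)
    (hσ : ∀ c ∈ A, σ c = c) : MorleyEquiv L A (σ ∘ a) (σ ∘ b) := by
  have key : ∀ x y : α → M, StartMorley L A x y → StartMorley L A (σ ∘ x) (σ ∘ y) := by
    rintro _ _ ⟨s, hs, rfl, rfl⟩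
    exact ⟨fun i => σ ∘ s i, hs.automorphism σ hσ, rfl, rfl⟩
  induction h with
  | single h => exact .single (h.imp (key _ _) (key _ _))
  | tail _ h ih => exact Relation.TransGen.tail ih (h.imp (key _ _) (key _ _))

theorem IsMonster.morleyEquiv_of_lascarChain (hM : IsMonster T κ M) (hA : #A < κ) (hα : #α < κ)
    {p : TypeOver L A α} (hp : Extensible p) {a b : α → M} (ha : tp L a A = p)
    (h : LascarChain L A a b) : MorleyEquiv L A a b := by
  rw [lascarChain_iff_reflTransGen] at h
  have : tp L b A = p ∧ MorleyEquiv L A a b := by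
    induction h with
    | refl => exact ⟨ha, hM.morleyEquiv_refl hA hα hp ha⟩
    | tail _ h ih =>
      exact ⟨h.tp_eq.symm.trans ih.1,
        ih.2.trans (hM.morleyEquiv_of_startIndiscernible hA hα hp ih.1 h)⟩
  exact this.2

theorem strictMono_pair {I : Type*} [Preorder I] {i j : I} (h : i < j) : StrictMono ![i, j] := by
  intro x y hxy
  fin_cases x <;> fin_cases y <;> simp_all

/-- Stretch each link of the chain to a length exceeding the number of classes. Two terms fall into
one class, and an automorphism over `A` carries them to the ends of the link. -/
theorem IsMonster.lascarEquiv_of_lascarChain (hM : IsMonster T κ M) (hA : #A < κ) (hα : #α < κ)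
    {a b : α → M} (h : LascarChain L A a b) : LascarEquiv L κ A a b := by
  intro E hE hcard
  rw [lascarChain_iff_reflTransGen] at h
  induction h with
  | refl => exact E.refl a
  | tail _ h ih =>
    refine E.trans ih ?_
    obtain ⟨s, hs, rfl, rfl⟩ := h
    let I := (Order.succ #(Quotient E)).ord.ToType
    obtain ⟨s', hs'⟩ := hM.exists_stretch hA hα (I := I) (by
      simpa [I] using hM.isStrongLimit.isSuccLimit.succ_lt hcard) hs
    have hni : ¬ Function.Injective (fun i : I => Quotient.mk E (s' i)) := fun hinj =>
      (Order.lt_succ #(Quotient E)).not_ge (by simpa [I] using Cardinal.mk_le_of_injective hinj)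
    have hlt : ∃ i j : I, i < j ∧ E (s' i) (s' j) := by
      simp only [Function.Injective] at hni
      push Not at hni
      obtain ⟨i, j, hij, hne⟩ := hni
      rcases lt_or_gt_of_ne hne with h | h
      · exact ⟨i, j, h, Quotient.exact hij⟩
      · exact ⟨j, i, h, Quotient.exact hij.symm⟩
    obtain ⟨i, j, hij, hEij⟩ := hlt
    obtain ⟨σ, hσ, hσ'⟩ := hM.exists_automorphism hA (hM.mk_fin_prod_lt hα 2)
      (hs' 2 ![i, j] ![0, 1] (strictMono_pair hij) (strictMono_pair Nat.zero_lt_one))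
    have h0 : σ ∘ s' i = s 0 := funext fun x => congrFun hσ' (0, x)
    have h1 : σ ∘ s' j = s 1 := funext fun x => congrFun hσ' (1, x)
    rw [← h0, ← h1]
    exact hE σ hσ _ _ hEij

/-- `≡'_A` on the realizations of `p`, extended by a single class of all other tuples. -/
def IsMonster.morleySetoid (hM : IsMonster T κ M) (hA : #A < κ) (hα : #α < κ)
    {p : TypeOver L A α} (hp : Extensible p) : Setoid (α → M) where
  r x y := (tp L x A ≠ p ∧ tp L y A ≠ p) ∨ (tp L x A = p ∧ tp L y A = p ∧ MorleyEquiv L A x y)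
  iseqv :=
    { refl := fun x => (em (tp L x A = p)).elim
        (fun h => Or.inr ⟨h, h, hM.morleyEquiv_refl hA hα hp h⟩) fun h => Or.inl ⟨h, h⟩
      symm := fun h => h.imp And.symm fun h => ⟨h.2.1, h.1, h.2.2.symm⟩
      trans := by
        rintro x y z (⟨hx, hy⟩ | ⟨hx, hy, hxy⟩) (⟨hy', hz⟩ | ⟨hy', hz, hyz⟩)
        · exact Or.inl ⟨hx, hz⟩
        · exact absurd hy' hy
        · exact absurd hy hy'
        · exact Or.inr ⟨hx, hz, hxy.trans hyz⟩ }

/-- From sufficiently many representatives of distinct classes, extraction produces two that start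
an indiscernible sequence. They have the same type over `A`, and if they realize `p` they are
`≡'_A`-equivalent, so their classes coincide. -/
theorem IsMonster.mk_quotient_morleySetoid_lt (hM : IsMonster T κ M) (hA : #A < κ) (hα : #α < κ)
    {p : TypeOver L A α} (hp : Extensible p) : #(Quotient (hM.morleySetoid hA hα hp)) < κ := by
  by_contra hcon
  obtain ⟨μ, hμ, hext⟩ := hM.exists_extraction (L := L) hA hα
  let X := μ.ord.ToType
  obtain ⟨f⟩ : #X ≤ #(Quotient (hM.morleySetoid hA hα hp)) := by
    simpa [X] using hμ.le.trans (not_lt.1 hcon)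
  obtain ⟨d, hd, hde⟩ := hext (X := X) (by simp [X]) (fun i => (f i).out)
  obtain ⟨e, he, h⟩ := hde 2
  obtain ⟨σ, hσ, hσ'⟩ := hM.exists_automorphism hA (hM.mk_fin_prod_lt hα 2)
    (h Fin.val Fin.val_strictMono)
  have hst : StartIndiscernible L A (f (e 0)).out (f (e 1)).out :=
    ⟨fun i => σ ∘ d i, hd.automorphism σ hσ, funext fun x => congrFun hσ' (0, x),
      funext fun x => congrFun hσ' (1, x)⟩
  have hE : hM.morleySetoid hA hα hp (f (e 0)).out (f (e 1)).out := by
    by_cases h0 : tp L (f (e 0)).out A = p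
    · exact Or.inr ⟨h0, hst.tp_eq.symm.trans h0,
        hM.morleyEquiv_of_startIndiscernible hA hα hp h0 hst⟩
    · exact Or.inl ⟨h0, fun h1 => h0 (hst.tp_eq.trans h1)⟩
  have := Quotient.sound hE
  rw [Quotient.out_eq, Quotient.out_eq] at this
  exact absurd (he.injective (f.injective this)) (by simp)

theorem IsMonster.morleyEquiv_of_lascarEquiv (hM : IsMonster T κ M) (hA : #A < κ) (hα : #α < κ)
    {p : TypeOver L A α} (hp : Extensible p) {a b : α → M} (ha : tp L a A = p)
    (h : LascarEquiv L κ A a b) : MorleyEquiv L A a b := by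
  have hinv : InvariantOver L A (hM.morleySetoid hA hα hp) := by
    rintro σ hσ x y (⟨hx, hy⟩ | ⟨hx, hy, hxy⟩)
    · exact Or.inl ⟨by rwa [tp_automorphism σ hσ], by rwa [tp_automorphism σ hσ]⟩
    · exact Or.inr ⟨by rwa [tp_automorphism σ hσ], by rwa [tp_automorphism σ hσ],
        hxy.automorphism σ hσ⟩
  rcases h _ hinv (hM.mk_quotient_morleySetoid_lt hA hα hp) with h1 | h1
  · exact absurd ha h1.1
  · exact h1.2.2

end Monster

end Forking


theorem mainTheorem5 {L : FirstOrder.Language.{u, v}} (T : L.Theory) (κ : Cardinal.{w})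
    (M : Type w) [L.Structure M] [Nonempty M] (hM : Forking.IsMonster T κ M)
    (A : Set M) (hA : #A < κ) (α : Type w) (hα : #α < κ)
    (p : Forking.TypeOver L A α) (hp : Forking.Extensible p)
    (a b : α → M) (ha : Forking.tp L a A = p) (hb : Forking.tp L b A = p) :
    (Forking.LascarEquiv L κ A a b ↔ Forking.MorleyEquiv L A a b) ∧
    (Forking.LascarChain L A a b ↔ Forking.MorleyEquiv L A a b) :=
  ⟨⟨hM.morleyEquiv_of_lascarEquiv hA hα hp ha, fun h =>
      hM.lascarEquiv_of_lascarChain hA hα (hM.lascarChain_of_morleyEquiv hA hα h)⟩,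
    ⟨hM.morleyEquiv_of_lascarChain hA hα hp ha, hM.lascarChain_of_morleyEquiv hA hα⟩⟩
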